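/- There exist absolute constants $c_1, c_2, c_3 > 0$ such that for every dimension $d \ge 1$ there is a probability distribution $\mathcal{D}$ over symmetric matrices $\Sigma \in \mathbb{R}^{d \times d}$ satisfying $\mathbb{I} \preceq \Sigma \preceq 2\mathbb{I}$ almost surely, with the following property. Let $n \in \mathbb{N}$, let $0 \le \alpha \le c_1/\sqrt{d}$, let $\varepsilon, \delta \in [0,1]$, and suppose that $\delta \le c_2 \min\left\{\frac{1}{n}, \frac{d^2}{n \log(n/d^2)}\right\}$, where the second term is read as $+\infty$ when $n \le d^2$; that is, $n\delta \le c_2$ and $n \delta \log(n/d^2) \le c_2 d^2$ (both conditions are void for $n = 0$). Let $M \colon (\mathbb{R}^{d})^n \to \mathbb{R}^{d \times d}$ be any $(\varepsilon,\delta)$-differentially private mechanism: a randomized algorithm (Markov kernel) such that $\Pr[M(X) \in Y] \le e^{\varepsilon} \Pr[M(X') \in Y] + \delta$ for all datasets $X, X'$ that differ in exactly one entry and all measurable sets $Y$. If, for $\Sigma \sim \mathcal{D}$ and, given $\Sigma$, $X = (X_1, \dots, X_n) \sim \mathcal{N}(0, \Sigma)^{\otimes n}$, \[ \mathbb{E}_{\Sigma,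 X, M}\left[\left\|\Sigma^{-1/2}\,(M(X) - \Sigma)\,\Sigma^{-1/2}\right\|_2^2\right] \le \alpha^2, \] where $\|\cdot\|_2$ is the spectral norm (largest singular value), then \[ n \ge c_3\, \frac{d^{3/2}}{\alpha \varepsilon}, \quad\text{that is,}\quad n \alpha \varepsilon \ge c_3\, d^{3/2}. \] In particular, no such mechanism exists if $n \alpha \varepsilon = 0$. -/

import Mathlib

open MeasureTheory ProbabilityTheory
open scoped MatrixOrder ENNReal

/-- Datasets of `n` points in `ℝ^d`. -/
abbrev Dataset (n d : ℕ) : Type := Fin n → EuclideanSpace ℝ (Fin d)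

/-- The Borel σ-algebra on real square matrices (the product σ-algebra on the entries). -/
instance instMeasurableSpaceSqMatrix (d : ℕ) : MeasurableSpace (Matrix (Fin d) (Fin d) ℝ) :=
  inferInstanceAs (MeasurableSpace (Fin d → Fin d → ℝ))

/-- Two datasets are neighbouring if they differ in exactly one entry. -/
def Neighboring {n : ℕ} {𝒳 : Type*} (X X' : Fin n → 𝒳) : Prop :=
  ∃! i, X i ≠ X' i

/-- `(ε, δ)`-differential privacy of a randomized algorithm, given as a kernel that sends a dataset
to the law of the output. -/
def IsDP {n : ℕ} {𝒳 𝒴 : Type*} [MeasurableSpace 𝒳] [MeasurableSpace 𝒴] (ε δ : ℝ)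
    (M : Kernel (Fin n → 𝒳) 𝒴) : Prop :=
  ∀ X X' : Fin n → 𝒳, Neighboring X X' → ∀ Y : Set 𝒴, MeasurableSet Y →
    M X Y ≤ ENNReal.ofReal (Real.exp ε) * M X' Y + ENNReal.ofReal δ

/-- The law of `n` independent samples from the Gaussian `N(0, S)`. -/
noncomputable def gaussianSamples (n : ℕ) {d : ℕ} (S : Matrix (Fin d) (Fin d) ℝ) :
    Measure (Dataset n d) :=
  Measure.pi fun _ => multivariateGaussian 0 S

/-- The spectral norm of a matrix: the operator norm with respect to the Euclidean norm. -/
noncomputable def spectralNorm2 {d : ℕ} (A : Matrix (Fin d) (Fin d) ℝ) : ℝ :=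
  ‖Matrix.toEuclideanCLM (𝕜 := ℝ) A‖

/-- The normalized spectral error `‖S^{-1/2} (B - S) S^{-1/2}‖₂`, for positive definite `S`. -/
noncomputable def normSpectralErr {d : ℕ} (S B : Matrix (Fin d) (Fin d) ℝ) : ℝ :=
  spectralNorm2 ((CFC.sqrt S)⁻¹ * (B - S) * (CFC.sqrt S)⁻¹)

/-- The mean squared normalized spectral error of the mechanism `M`, the mean being over the prior
`Σ ∼ D`, over the `n` samples from `N(0, Σ)`, and over the randomness of `M`. -/
noncomputable def meanSqSpectralErr {n d : ℕ} (D : Measure (Matrix (Fin d) (Fin d) ℝ))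
    (M : Kernel (Dataset n d) (Matrix (Fin d) (Fin d) ℝ)) : ℝ≥0∞ :=
  ∫⁻ S, ∫⁻ X, ∫⁻ B, ENNReal.ofReal (normSpectralErr S B ^ 2) ∂(M X) ∂(gaussianSamples n S) ∂D

/-! The proof is a fingerprinting argument. Take Σ = P⁻¹ with P = (3/4)I + (θ + θᵀ)/2, the d²
entries of θ being independent and uniform on [-r, r] with r = 1/(4d); then I ≤ Σ ≤ 2I. In terms of
the precision matrix the Gaussian log-density is linear up to log det, so the score in the entry a =
(i, j) is simply (Σ_a - x_i x_j)/2.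

Truncate the output of the mechanism to a matrix B near (4/3)I (`resetMat`), and correlate its error
with each sample point: A_k = ∑_a (r² - θ_a²)(B - Σ)_a score_a(X_k), which is `attack`.

The total correlation cannot be small. Integrating by parts in each θ_a against the weight r² -
θ_a², which vanishes at the endpoints, gives E ∑_k A_k = 2 E⟨θ, B⟩ (`fingerprint_identity`,
`sum_integral_attack_eq`). An accurate B may be replaced by Σ at small cost
(`sum_param_mul_meanEst_le`), and E⟨θ, Σ⟩ is at most a negative absolute constant, because Σ is a
decreasing function of θ (`sum_param_mul_covMat_le`, `le_integral_frobSq_symPart`). Hence -E ∑_k A_k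
is at least a positive constant.

Privacy makes each term small (`neg_integral_attack_le`). Up to ε and δ the point X_k may be tested
against an output computed without it. The correlation then has mean zero and, for fixed B, variance
of order r⁴‖B - Σ‖_F², with mean of order r⁴dα². The truncation bounds |A_k| by a multiple of r²(d +
|X_k|²) uniformly in the output, so δ is charged only of order r²d. Thus -E A_k is at most of order
ε r² √d α + δ r² d.

Summing over k, with r² of order d⁻², a constant is at most of order nεα d^(-3/2) + nδ/d; the second
term is absorbed when nδ is small, and the claim follows. -/

/-! ### Product measures and integration by parts. -/

/-- Resampling one coordinate leaves a product measure unchanged. This serves twice: to replace a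
data point by a fresh one, and to isolate one coordinate of θ. -/
theorem measurePreserving_update_pi {ι : Type*} [Fintype ι] [DecidableEq ι] {α : Type*}
    [MeasurableSpace α] (μ : Measure α) [IsProbabilityMeasure μ] (k : ι) :
    MeasurePreserving (fun p : (ι → α) × α => Function.update p.1 k p.2)
      ((Measure.pi fun _ : ι => μ).prod μ) (Measure.pi fun _ : ι => μ) := by
  have hm : Measurable (fun p : (ι → α) × α => Function.update p.1 k p.2) := by
    refine measurable_pi_lambda _ fun i => ?_
    by_cases h : i = k
    · subst h; simpa using measurable_snd
    · simpa [Function.update_of_ne h, Function.comp_def] using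
        (measurable_pi_apply (X := fun _ => α) i).comp measurable_fst
  refine ⟨hm, ?_⟩
  refine (Measure.pi_eq fun s hs => ?_).symm
  rw [Measure.map_apply hm (MeasurableSet.univ_pi hs)]
  have : (fun p : (ι → α) × α => Function.update p.1 k p.2) ⁻¹' Set.univ.pi s =
      (Set.univ.pi (Function.update s k Set.univ)) ×ˢ (s k) := by
    ext ⟨X, x⟩
    simp only [Set.mem_preimage, Set.mem_univ_pi, Set.mem_prod]
    constructor
    · refine fun h => ⟨fun i => ?_, by simpa using h k⟩
      by_cases hi : i = k
      · subst hi; simp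
      · simpa [Function.update_of_ne hi] using h i
    · rintro ⟨h1, h2⟩ i
      by_cases hi : i = k
      · subst hi; simpa using h2
      · simpa [Function.update_of_ne hi] using h1 i
  rw [this, Measure.prod_prod, Measure.pi_pi, ← Finset.prod_erase_mul _ _ (Finset.mem_univ k),
    ← Finset.prod_erase_mul (s := Finset.univ) (f := fun i => μ (s i)) (h := Finset.mem_univ k)]
  simp only [Function.update_self, measure_univ, mul_one]
  congr 1
  refine Finset.prod_congr rfl fun i hi => ?_
  rw [Function.update_of_ne (Finset.ne_of_mem_erase hi)]

theorem pi_withDensity_ofReal {ι : Type*} [Fintype ι] {α : Type*}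
    [MeasurableSpace α] (μ : Measure α) [SigmaFinite μ] {f : α → ℝ}
    (hf0 : ∀ x, 0 ≤ f x) (hfi : Integrable f μ) :
    Measure.pi (fun _ : ι => μ.withDensity fun x => ENNReal.ofReal (f x)) =
      (Measure.pi fun _ : ι => μ).withDensity fun X => ENNReal.ofReal (∏ k, f (X k)) := by
  have : IsFiniteMeasure (μ.withDensity fun x => ENNReal.ofReal (f x)) :=
    isFiniteMeasure_withDensity_ofReal hfi.2
  refine Measure.pi_eq fun s hs => ?_
  rw [withDensity_apply _ (MeasurableSet.univ_pi hs), Measure.restrict_pi_pi,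
    ← ofReal_integral_eq_lintegral_ofReal
      (Integrable.fintype_prod (f := fun _ => f) fun i => hfi.restrict)
      (.of_forall fun X => Finset.prod_nonneg fun k _ => hf0 _),
    integral_fintype_prod_eq_prod (fun _ => f),
    ENNReal.ofReal_prod_of_nonneg fun i _ => integral_nonneg fun x => hf0 x]
  refine Finset.prod_congr rfl fun i _ => ?_
  rw [withDensity_apply _ (hs i),
    ofReal_integral_eq_lintegral_ofReal hfi.restrict (.of_forall hf0)]

/-- The weight r² - t² vanishes at ±r, so integration by parts leaves no boundary term even though
`q` is arbitrary there. -/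
theorem integral_parabola_mul_deriv {r : ℝ} (hr : 0 < r) {q q' : ℝ → ℝ}
    (hq : ∀ t ∈ Set.Icc (-r) r, HasDerivAt q (q' t) t) (hq' : ContinuousOn q' (Set.Icc (-r) r)) :
    ∫ t in Set.Icc (-r) r, (r ^ 2 - t ^ 2) * q' t = ∫ t in Set.Icc (-r) r, 2 * t * q t := by
  have hle : -r ≤ r := by linarith
  rw [integral_Icc_eq_integral_Ioc, integral_Icc_eq_integral_Ioc,
    ← intervalIntegral.integral_of_le hle, ← intervalIntegral.integral_of_le hle]
  rw [intervalIntegral.integral_mul_deriv_eq_deriv_mul (u' := fun t => - (2 * t)) (v := q)]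
  · simp [intervalIntegral.integral_neg]
  · intro t _
    simpa using ((hasDerivAt_pow 2 t).const_sub (r ^ 2))
  · rw [Set.uIcc_of_le hle]; exact hq
  · exact (by fun_prop : Continuous fun t : ℝ => -(2 * t)).intervalIntegrable _ _
  · exact ContinuousOn.intervalIntegrable (by rwa [Set.uIcc_of_le hle])

/-! ### Comparing expectations under approximate privacy. -/

/-- Layer-cake formula: apply the hypothesis to each set {f > t}. These sets are empty for t ≥ K, so
`e` is charged only over an interval of length K. -/
theorem lintegral_le_of_measure_le {𝒴 : Type*} [MeasurableSpace 𝒴] {P Q : Measure 𝒴}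
    {c e : ℝ≥0∞} (h : ∀ Y, MeasurableSet Y → P Y ≤ c * Q Y + e)
    {f : 𝒴 → ℝ} (hf : Measurable f) (hf0 : ∀ y, 0 ≤ f y) {K : ℝ} (hK : ∀ y, f y ≤ K) :
    ∫⁻ y, ENNReal.ofReal (f y) ∂P ≤ c * ∫⁻ y, ENNReal.ofReal (f y) ∂Q + e * ENNReal.ofReal K := by
  rw [lintegral_eq_lintegral_meas_lt _ (Filter.Eventually.of_forall hf0) hf.aemeasurable,
    lintegral_eq_lintegral_meas_lt _ (Filter.Eventually.of_forall hf0) hf.aemeasurable]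
  have hmeas : Measurable fun t : ℝ => Q {a | t < f a} :=
    Antitone.measurable fun s t hst => measure_mono fun a (ha : t < f a) => lt_of_le_of_lt hst ha
  calc ∫⁻ t in Set.Ioi (0:ℝ), P {a | t < f a}
      ≤ ∫⁻ t in Set.Ioi (0:ℝ), (c * Q {a | t < f a} + (Set.Iio K).indicator (fun _ => e) t) := by
        refine lintegral_mono fun t => ?_
        by_cases ht : t < K
        · have := h {a | t < f a} (hf measurableSet_Ioi)
          simpa [ht] using this
        · have : {a | t < f a} = ∅ := by
            ext a; simpa using (hK a).trans (not_lt.1 ht)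
          simp [this]
    _ = _ := by
        rw [lintegral_add_left (hmeas.const_mul c), lintegral_const_mul _ hmeas,
          lintegral_indicator measurableSet_Iio, lintegral_const, Measure.restrict_restrict measurableSet_Iio]
        congr 2
        rw [Measure.restrict_apply_univ, Set.inter_comm, Set.Ioi_inter_Iio, Real.volume_Ioo, sub_zero]

theorem integral_le_of_measure_le {𝒴 : Type*} [MeasurableSpace 𝒴] {P Q : Measure 𝒴}
    [IsProbabilityMeasure P] [IsProbabilityMeasure Q]
    {ε δ : ℝ} (hδ : 0 ≤ δ) (h : ∀ Y, MeasurableSet Y →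
      P Y ≤ ENNReal.ofReal (Real.exp ε) * Q Y + ENNReal.ofReal δ)
    {f : 𝒴 → ℝ} (hf : Measurable f) (hf0 : ∀ y, 0 ≤ f y) {K : ℝ} (hK : ∀ y, f y ≤ K) :
    ∫ y, f y ∂P ≤ Real.exp ε * ∫ y, f y ∂Q + δ * K := by
  have hK0 : 0 ≤ K := by
    obtain ⟨y⟩ := nonempty_of_isProbabilityMeasure P
    exact (hf0 y).trans (hK y)
  have hi : ∀ R : Measure 𝒴, IsProbabilityMeasure R → Integrable f R := fun R _ =>
    Integrable.of_bound hf.aestronglyMeasurable K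
      (Filter.Eventually.of_forall fun y => by rw [Real.norm_of_nonneg (hf0 y)]; exact hK y)
  have := lintegral_le_of_measure_le h hf hf0 hK
  rw [← ofReal_integral_eq_lintegral_ofReal (hi P inferInstance) (.of_forall hf0),
    ← ofReal_integral_eq_lintegral_ofReal (hi Q inferInstance) (.of_forall hf0),
    ← ENNReal.ofReal_mul (Real.exp_pos _).le, ← ENNReal.ofReal_mul hδ, ← ENNReal.ofReal_add,
    ENNReal.ofReal_le_ofReal_iff] at this
  · exact this
  all_goals have := integral_nonneg (μ := Q) (f := f) hf0
  all_goals positivity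

/-- Split f into positive and negative parts: the positive part uses the comparison of `P` with `Q`,
the negative part the reverse one. The multiplicative loss falls on ∫|f| under `Q` alone, which
later is the law whose output is independent of the tested point. -/
theorem integral_le_integral_add_of_measure_le {𝒴 : Type*} [MeasurableSpace 𝒴] {P Q : Measure 𝒴}
    [IsProbabilityMeasure P] [IsProbabilityMeasure Q]
    {ε δ : ℝ} (hε : 0 ≤ ε) (hε1 : ε ≤ 1) (hδ : 0 ≤ δ) (h : ∀ Y, MeasurableSet Y →
      P Y ≤ ENNReal.ofReal (Real.exp ε) * Q Y + ENNReal.ofReal δ)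
    (h' : ∀ Y, MeasurableSet Y → Q Y ≤ ENNReal.ofReal (Real.exp ε) * P Y + ENNReal.ofReal δ)
    {f : 𝒴 → ℝ} (hf : Measurable f) {K : ℝ} (hK : ∀ y, |f y| ≤ K) :
    ∫ y, f y ∂P ≤ ∫ y, f y ∂Q + 2 * ε * ∫ y, |f y| ∂Q + 2 * δ * K := by
  have hi : ∀ R : Measure 𝒴, IsProbabilityMeasure R → ∀ g : 𝒴 → ℝ, Measurable g →
      (∀ y, |g y| ≤ K) → Integrable g R := fun R _ g hg hgK =>
    Integrable.of_bound hg.aestronglyMeasurable K (Filter.Eventually.of_forall hgK)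
  set p : 𝒴 → ℝ := fun y => max (f y) 0 with hp
  set m : 𝒴 → ℝ := fun y => max (-f y) 0 with hm
  have hpm : Measurable p := hf.max measurable_const
  have hmm : Measurable m := hf.neg.max measurable_const
  have hp0 : ∀ y, 0 ≤ p y := fun y => le_max_right _ _
  have hm0 : ∀ y, 0 ≤ m y := fun y => le_max_right _ _
  have hpK : ∀ y, p y ≤ K := fun y => max_le ((le_abs_self _).trans (hK y)) ((abs_nonneg _).trans (hK y))
  have hmK : ∀ y, m y ≤ K := fun y => max_le ((neg_le_abs _).trans (hK y)) ((abs_nonneg _).trans (hK y))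
  have hpi : ∀ R : Measure 𝒴, IsProbabilityMeasure R → Integrable p R := fun R hR =>
    hi R hR p hpm fun y => by rw [abs_of_nonneg (hp0 y)]; exact hpK y
  have hmi : ∀ R : Measure 𝒴, IsProbabilityMeasure R → Integrable m R := fun R hR =>
    hi R hR m hmm fun y => by rw [abs_of_nonneg (hm0 y)]; exact hmK y
  have e1 : ∀ y, f y = p y - m y := fun y => by
    simp only [hp, hm]; rcases le_total 0 (f y) with h | h
    · rw [max_eq_left h, max_eq_right (by linarith)]; ring
    · rw [max_eq_right h, max_eq_left (by linarith)]; ring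
  have e2 : ∀ y, |f y| = p y + m y := fun y => by
    simp only [hp, hm]; rcases le_total 0 (f y) with h | h
    · rw [max_eq_left h, max_eq_right (by linarith), abs_of_nonneg h]; ring
    · rw [max_eq_right h, max_eq_left (by linarith), abs_of_nonpos h]; ring
  rw [show (∫ y, |f y| ∂Q) = ∫ y, p y + m y ∂Q from by simp only [e2]]
  simp only [e1]
  rw [integral_sub (hpi P inferInstance) (hmi P inferInstance),
    integral_sub (hpi Q inferInstance) (hmi Q inferInstance),
    integral_add (hpi Q inferInstance) (hmi Q inferInstance)]
  have a1 := integral_le_of_measure_le hδ h hpm hp0 hpK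
  have a2 := integral_le_of_measure_le hδ h' hmm hm0 hmK
  have b1 : 0 ≤ ∫ y, p y ∂Q := integral_nonneg hp0
  have b2 : 0 ≤ ∫ y, m y ∂Q := integral_nonneg hm0
  have b3 : 0 ≤ ∫ y, m y ∂P := integral_nonneg hm0
  have hexp : Real.exp ε ≤ 1 + 2 * ε := by
    have := Real.abs_exp_sub_one_le (x := ε) (by rwa [abs_of_nonneg hε])
    rw [abs_of_nonneg hε] at this
    linarith [le_abs_self (Real.exp ε - 1)]
  have hexp1 : 1 ≤ Real.exp ε := Real.one_le_exp hε
  have c1 : Real.exp ε * ∫ y, p y ∂Q ≤ (1 + 2 * ε) * ∫ y, p y ∂Q :=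
    mul_le_mul_of_nonneg_right hexp b1
  have hK0 : 0 ≤ δ * K := by
    obtain ⟨y⟩ := nonempty_of_isProbabilityMeasure P
    exact mul_nonneg hδ ((hp0 y).trans (hpK y))
  -- Since e^ε ≤ 1 + 2ε and (1 + 2ε)(1 - 2ε) ≤ 1, the factor e^ε can be moved to the other side; if
  -- 1 - 2ε ≤ 0 there is nothing to prove.
  have c2 : (∫ y, m y ∂Q) * (1 - 2 * ε) ≤ ∫ y, m y ∂P + δ * K := by
    by_cases h0 : 1 - 2 * ε ≤ 0
    · nlinarith
    · have h1 : (1 + 2 * ε) * (1 - 2 * ε) ≤ 1 := by nlinarith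
      have h2 : ∫ y, m y ∂Q ≤ (1 + 2 * ε) * ((∫ y, m y ∂P) + δ * K) := by nlinarith
      have h3 := mul_le_mul_of_nonneg_right h2 (not_le.1 h0).le
      nlinarith
  nlinarith

/-! ### Frobenius norm, quadratic forms and the spectral error. -/

/-- The squared Frobenius norm of a real square matrix. -/
def frobSq {d : ℕ} (A : Matrix (Fin d) (Fin d) ℝ) : ℝ := ∑ i, ∑ j, A i j ^ 2

/-- The quadratic form `xᵀ A x`. -/
def quadForm {d : ℕ} (A : Matrix (Fin d) (Fin d) ℝ) (x : EuclideanSpace ℝ (Fin d)) : ℝ :=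
  ∑ i, ∑ j, A i j * (x i * x j)

theorem frobSq_nonneg {d : ℕ} (A : Matrix (Fin d) (Fin d) ℝ) : 0 ≤ frobSq A :=
  Finset.sum_nonneg fun _ _ => Finset.sum_nonneg fun _ _ => sq_nonneg _

theorem frobSq_eq_trace {d : ℕ} (A : Matrix (Fin d) (Fin d) ℝ) :
    frobSq A = (A.transpose * A).trace := by
  simp only [frobSq, Matrix.trace, Matrix.diag, Matrix.mul_apply, Matrix.transpose_apply]
  rw [Finset.sum_comm]
  simp [sq]

theorem frobSq_transpose {d : ℕ} (A : Matrix (Fin d) (Fin d) ℝ) :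
    frobSq A.transpose = frobSq A := by
  simp only [frobSq, Matrix.transpose_apply]
  exact Finset.sum_comm

theorem sum_sum_mul_eq_trace {d : ℕ} (A B : Matrix (Fin d) (Fin d) ℝ) :
    ∑ i, ∑ j, A i j * B i j = (A.transpose * B).trace := by
  simp only [Matrix.trace, Matrix.diag, Matrix.mul_apply, Matrix.transpose_apply]
  exact Finset.sum_comm

theorem quadForm_eq_dotProduct {d : ℕ} (A : Matrix (Fin d) (Fin d) ℝ)
    (x : EuclideanSpace ℝ (Fin d)) : quadForm A x = x.ofLp ⬝ᵥ A.mulVec x.ofLp := by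
  simp only [quadForm, dotProduct, Matrix.mulVec, Finset.mul_sum]
  exact Finset.sum_congr rfl fun i _ => Finset.sum_congr rfl fun j _ => by ring

/-- The symmetric part of a matrix. -/
noncomputable def symPart {d : ℕ} (A : Matrix (Fin d) (Fin d) ℝ) : Matrix (Fin d) (Fin d) ℝ :=
  (1 / 2 : ℝ) • (A + A.transpose)

theorem symPart_apply {d : ℕ} (A : Matrix (Fin d) (Fin d) ℝ) (i j : Fin d) :
    symPart A i j = (A i j + A j i) / 2 := by
  simp [symPart]; ring

theorem symPart_transpose {d : ℕ} (A : Matrix (Fin d) (Fin d) ℝ) :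
    (symPart A).transpose = symPart A := by
  ext i j; simp only [Matrix.transpose_apply, symPart_apply]; ring

theorem quadForm_symPart {d : ℕ} (A : Matrix (Fin d) (Fin d) ℝ) (x : EuclideanSpace ℝ (Fin d)) :
    quadForm (symPart A) x = quadForm A x := by
  have h : ∑ i, ∑ j, A j i * (x i * x j) = quadForm A x := by
    rw [Finset.sum_comm]
    exact Finset.sum_congr rfl fun i _ => Finset.sum_congr rfl fun j _ => by ring
  have : quadForm (symPart A) x = (quadForm A x + ∑ i, ∑ j, A j i * (x i * x j)) / 2 := by
    simp only [quadForm, symPart_apply, ← Finset.sum_add_distrib, Finset.sum_div]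
    exact Finset.sum_congr rfl fun i _ => Finset.sum_congr rfl fun j _ => by ring
  rw [this, h]; ring

theorem sum_symPart_mul {d : ℕ} (A : Matrix (Fin d) (Fin d) ℝ) {S : Matrix (Fin d) (Fin d) ℝ}
    (hS : S.transpose = S) :
    ∑ i, ∑ j, symPart A i j * S i j = ∑ i, ∑ j, A i j * S i j := by
  have hS' : ∀ i j, S j i = S i j := fun i j => by rw [← Matrix.transpose_apply S, hS]
  have h : ∑ i, ∑ j, A j i * S i j = ∑ i, ∑ j, A i j * S i j := by
    rw [Finset.sum_comm]
    exact Finset.sum_congr rfl fun i _ => Finset.sum_congr rfl fun j _ => by rw [hS']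
  have : ∑ i, ∑ j, symPart A i j * S i j =
      (∑ i, ∑ j, A i j * S i j + ∑ i, ∑ j, A j i * S i j) / 2 := by
    simp only [symPart_apply, ← Finset.sum_add_distrib, Finset.sum_div]
    exact Finset.sum_congr rfl fun i _ => Finset.sum_congr rfl fun j _ => by ring
  rw [this, h]; ring

theorem frobSq_symPart_le {d : ℕ} (A : Matrix (Fin d) (Fin d) ℝ) :
    frobSq (symPart A) ≤ frobSq A := by
  have h : frobSq (symPart A) ≤ (frobSq A + frobSq A.transpose) / 2 := by
    simp only [frobSq, symPart_apply, Matrix.transpose_apply, ← Finset.sum_add_distrib,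
      Finset.sum_div]
    exact Finset.sum_le_sum fun i _ => Finset.sum_le_sum fun j _ => by
      nlinarith [sq_nonneg (A i j - A j i)]
  rw [frobSq_transpose] at h; linarith

theorem trace_transpose_mul_mul_le {d : ℕ} {S : Matrix (Fin d) (Fin d) ℝ}
    (h2 : S ≤ (2 : ℝ) • 1) (A : Matrix (Fin d) (Fin d) ℝ) :
    (A.transpose * S * A).trace ≤ 2 * frobSq A := by
  have h := (Matrix.le_iff.1 h2).conjTranspose_mul_mul_same A
  have h := h.trace_nonneg
  rw [Matrix.conjTranspose_eq_transpose_of_trivial, Matrix.mul_sub, Matrix.sub_mul,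
    Matrix.trace_sub] at h
  simp only [Matrix.mul_smul, Matrix.mul_one, Matrix.smul_mul, Matrix.trace_smul,
    ← frobSq_eq_trace, smul_eq_mul] at h
  linarith

theorem le_trace_transpose_mul_mul {d : ℕ} {S : Matrix (Fin d) (Fin d) ℝ}
    (h1 : 1 ≤ S) (A : Matrix (Fin d) (Fin d) ℝ) :
    frobSq A ≤ (A.transpose * S * A).trace := by
  have h := (Matrix.le_iff.1 h1).conjTranspose_mul_mul_same A
  have h := h.trace_nonneg
  rw [Matrix.conjTranspose_eq_transpose_of_trivial, Matrix.mul_sub, Matrix.sub_mul,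
    Matrix.trace_sub] at h
  simp only [Matrix.mul_one, ← frobSq_eq_trace] at h
  linarith

theorem sqrt_transpose {d : ℕ} (S : Matrix (Fin d) (Fin d) ℝ) :
    (CFC.sqrt S).transpose = CFC.sqrt S := by
  have := (Matrix.nonneg_iff_posSemidef.1 (CFC.sqrt_nonneg S)).isHermitian
  rwa [Matrix.IsHermitian, Matrix.conjTranspose_eq_transpose_of_trivial] at this

theorem frobSq_sqrt_mul_le {d : ℕ} {S : Matrix (Fin d) (Fin d) ℝ} (h0 : 0 ≤ S)
    (h2 : S ≤ (2 : ℝ) • 1) (A : Matrix (Fin d) (Fin d) ℝ) :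
    frobSq (CFC.sqrt S * A) ≤ 2 * frobSq A := by
  rw [frobSq_eq_trace, Matrix.transpose_mul, sqrt_transpose]
  have : A.transpose * CFC.sqrt S * (CFC.sqrt S * A) = A.transpose * S * A := by
    rw [← Matrix.mul_assoc, Matrix.mul_assoc A.transpose, CFC.sqrt_mul_sqrt_self S h0]
  rw [this]
  exact trace_transpose_mul_mul_le h2 A

theorem frobSq_sqrt_mul_mul_sqrt_le {d : ℕ} {S : Matrix (Fin d) (Fin d) ℝ} (h0 : 0 ≤ S)
    (h2 : S ≤ (2 : ℝ) • 1) (A : Matrix (Fin d) (Fin d) ℝ) :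
    frobSq (CFC.sqrt S * A * CFC.sqrt S) ≤ 4 * frobSq A := by
  have h1 : frobSq (A * CFC.sqrt S) ≤ 2 * frobSq A := by
    rw [← frobSq_transpose, Matrix.transpose_mul, sqrt_transpose, ← frobSq_transpose A]
    exact frobSq_sqrt_mul_le h0 h2 _
  rw [Matrix.mul_assoc]
  linarith [frobSq_sqrt_mul_le h0 h2 (A * CFC.sqrt S)]

theorem isUnit_det_of_one_le {d : ℕ} {S : Matrix (Fin d) (Fin d) ℝ} (h1 : 1 ≤ S) :
    IsUnit (CFC.sqrt S).det := by
  have hp : S.PosDef := by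
    have := Matrix.PosDef.one.add_posSemidef (Matrix.le_iff.1 h1)
    simpa using this
  have h := congrArg Matrix.det (CFC.sqrt_mul_sqrt_self S hp.posSemidef.nonneg)
  rw [Matrix.det_mul] at h
  exact isUnit_iff_ne_zero.2 fun h0 => hp.det_pos.ne' (by rw [← h, h0, mul_zero])

theorem frobSq_le_mul_spectralNorm2_sq {d : ℕ} (A : Matrix (Fin d) (Fin d) ℝ) :
    frobSq A ≤ d * spectralNorm2 A ^ 2 := by
  have h : ∀ j, ∑ i, A i j ^ 2 ≤ spectralNorm2 A ^ 2 := fun j => by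
    have := (Matrix.toEuclideanCLM (𝕜 := ℝ) A).le_opNorm (EuclideanSpace.single j 1)
    rw [PiLp.norm_single, norm_one, mul_one] at this
    have h2 := pow_le_pow_left₀ (norm_nonneg _) this 2
    rw [EuclideanSpace.real_norm_sq_eq] at h2
    refine le_trans (le_of_eq ?_) h2
    refine Finset.sum_congr rfl fun i _ => ?_
    simp [Matrix.ofLp_toEuclideanCLM]
  rw [← frobSq_transpose]
  calc frobSq A.transpose ≤ ∑ _j : Fin d, spectralNorm2 A ^ 2 :=
        Finset.sum_le_sum fun j _ => h j
    _ = _ := by simp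

/-- Undoing the normalization by S^(1/2) on both sides costs 2 · 2, and passing from the spectral to
the Frobenius norm costs d. -/
theorem frobSq_sub_le_normSpectralErr {d : ℕ} {S : Matrix (Fin d) (Fin d) ℝ} (h1 : 1 ≤ S)
    (h2 : S ≤ (2 : ℝ) • 1) (B : Matrix (Fin d) (Fin d) ℝ) :
    frobSq (B - S) ≤ 4 * d * normSpectralErr S B ^ 2 := by
  have hu := isUnit_det_of_one_le h1
  have h0 : 0 ≤ S := zero_le_one.trans h1
  have e : B - S = CFC.sqrt S * ((CFC.sqrt S)⁻¹ * (B - S) * (CFC.sqrt S)⁻¹) * CFC.sqrt S := by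
    rw [Matrix.mul_assoc (CFC.sqrt S)⁻¹, Matrix.mul_nonsing_inv_cancel_left _ _ hu,
      Matrix.nonsing_inv_mul_cancel_right _ _ hu]
  rw [e]
  refine (frobSq_sqrt_mul_mul_sqrt_le h0 h2 _).trans ?_
  have := frobSq_le_mul_spectralNorm2_sq ((CFC.sqrt S)⁻¹ * (B - S) * (CFC.sqrt S)⁻¹)
  rw [normSpectralErr]
  linarith

/-! ### The Gaussian density in terms of the precision matrix. -/

/-- The density of the Gaussian with mean zero and precision matrix `P`. -/
noncomputable def precisionDensity {d : ℕ} (P : Matrix (Fin d) (Fin d) ℝ)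
    (x : EuclideanSpace ℝ (Fin d)) : ℝ :=
  (√(2 * Real.pi))⁻¹ ^ d * √P.det * Real.exp (-(quadForm P x) / 2)

theorem precisionDensity_nonneg {d : ℕ} (P : Matrix (Fin d) (Fin d) ℝ)
    (x : EuclideanSpace ℝ (Fin d)) : 0 ≤ precisionDensity P x := by
  unfold precisionDensity; positivity

theorem continuous_quadForm {d : ℕ} : Continuous
    fun p : Matrix (Fin d) (Fin d) ℝ × EuclideanSpace ℝ (Fin d) => quadForm p.1 p.2 := by
  unfold quadForm
  refine continuous_finsetSum _ fun i _ => continuous_finsetSum _ fun j _ => ?_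
  have : Continuous fun p : Matrix (Fin d) (Fin d) ℝ × EuclideanSpace ℝ (Fin d) => p.1 i j :=
    continuous_fst.matrix_elem i j
  fun_prop

theorem continuous_precisionDensity {d : ℕ} : Continuous
    fun p : Matrix (Fin d) (Fin d) ℝ × EuclideanSpace ℝ (Fin d) => precisionDensity p.1 p.2 := by
  unfold precisionDensity
  have h1 : Continuous fun p : Matrix (Fin d) (Fin d) ℝ × EuclideanSpace ℝ (Fin d) => √p.1.det :=
    Real.continuous_sqrt.comp continuous_fst.matrix_det
  have h2 := continuous_quadForm (d := d)
  fun_prop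

theorem pi_gaussianReal_eq_withDensity (d : ℕ) :
    (Measure.pi fun _ : Fin d => gaussianReal 0 1) =
      (volume : Measure (Fin d → ℝ)).withDensity
        fun z => ENNReal.ofReal (∏ i, gaussianPDFReal 0 1 (z i)) := by
  have h : gaussianReal 0 1 = volume.withDensity fun x => ENNReal.ofReal (gaussianPDFReal 0 1 x) := by
    rw [gaussianReal_of_var_ne_zero _ one_ne_zero]; rfl
  rw [h, pi_withDensity_ofReal _ (fun x => gaussianPDFReal_nonneg 0 1 x)
    (integrable_gaussianPDFReal 0 1)]
  rfl

theorem prod_gaussianPDFReal {d : ℕ} (z : Fin d → ℝ) :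
    ∏ i, gaussianPDFReal 0 1 (z i) = (√(2 * Real.pi))⁻¹ ^ d * Real.exp (-(∑ i, z i ^ 2) / 2) := by
  simp only [gaussianPDFReal, NNReal.coe_one, mul_one, sub_zero, Finset.prod_mul_distrib,
    Finset.prod_const, Finset.card_univ, Fintype.card_fin, ← Real.exp_sum]
  congr 2
  rw [← Finset.sum_neg_distrib, Finset.sum_div]

/-- Change of variables x = Rz with R = (P⁻¹)^(1/2), starting from independent standard coordinates;
|det R⁻¹| = √(det P) and |R⁻¹x|² = xᵀPx. -/
theorem multivariateGaussian_inv_eq_withDensity {d : ℕ} {P : Matrix (Fin d) (Fin d) ℝ}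
    (hP : P.PosDef) :
    multivariateGaussian 0 P⁻¹ = (volume : Measure (EuclideanSpace ℝ (Fin d))).withDensity
      fun x => ENNReal.ofReal (precisionDensity P x) := by
  have hS : P⁻¹.PosDef := hP.inv
  set R := CFC.sqrt P⁻¹ with hR
  have hRR : R * R = P⁻¹ := CFC.sqrt_mul_sqrt_self _ hS.posSemidef.nonneg
  have hdet : R.det * R.det = (P.det)⁻¹ := by
    rw [← Matrix.det_mul, hRR, Matrix.det_nonsing_inv, Ring.inverse_eq_inv']
  have hPd := hP.det_pos
  have hR0 : R.det ≠ 0 := fun h => by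
    rw [h, mul_zero] at hdet; exact (inv_pos.2 hPd).ne hdet
  have hRt : R.transpose = R := sqrt_transpose _
  have hu : IsUnit R.det := isUnit_iff_ne_zero.2 hR0
  have habs : |(R.det)⁻¹| = √P.det := by
    rw [← Real.sqrt_sq_eq_abs, sq, ← mul_inv, hdet, inv_inv]
  have hsq : ∀ x : Fin d → ℝ, ∑ i, (R⁻¹.mulVec x i) ^ 2 = quadForm P (WithLp.toLp 2 x) := by
    intro x
    have hPe : P = R⁻¹ * R⁻¹ := by
      rw [← Matrix.mul_inv_rev, hRR, Matrix.nonsing_inv_nonsing_inv _ (isUnit_iff_ne_zero.2 hPd.ne')]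
    have ht : (R⁻¹).transpose = R⁻¹ := by rw [Matrix.transpose_nonsing_inv, hRt]
    rw [quadForm_eq_dotProduct, hPe, ← Matrix.mulVec_mulVec, Matrix.dotProduct_mulVec,
      ← Matrix.mulVec_transpose, ht]
    simp [dotProduct, sq]
  have hmvol := Real.map_matrix_volume_pi_eq_smul_volume_pi hR0
  rw [habs] at hmvol
  have hdm : Measurable (precisionDensity P) :=
    (continuous_precisionDensity.comp (continuous_const.prodMk continuous_id)).measurable
  refine Measure.ext_of_lintegral _ fun f hf => ?_
  have htl : Measurable (WithLp.toLp 2 : (Fin d → ℝ) → EuclideanSpace ℝ (Fin d)) := by fun_prop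
  have hlin : Measurable (Matrix.toLin' R) :=
    (LinearMap.continuous_of_finiteDimensional _).measurable
  have hprod : Measurable fun z : Fin d → ℝ => ENNReal.ofReal (∏ i, gaussianPDFReal 0 1 (z i)) := by
    have := measurable_gaussianPDFReal 0 1
    exact (Finset.measurable_prod _ fun i _ => this.comp (measurable_pi_apply i)).ennreal_ofReal
  rw [multivariateGaussian, lintegral_map hf (by fun_prop), ← map_pi_eq_stdGaussian,
    lintegral_map (by fun_prop) htl, pi_gaussianReal_eq_withDensity,
    lintegral_withDensity_eq_lintegral_mul _ hprod (by fun_prop),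
    lintegral_withDensity_eq_lintegral_mul _ hdm.ennreal_ofReal hf,
    ← (PiLp.volume_preserving_toLp (Fin d)).lintegral_comp (by fun_prop)]
  -- The integrand is rewritten as a function of Rz, so that the image of Lebesgue measure under R
  -- can be inserted.
  have key : ∀ z : Fin d → ℝ, ((fun z : Fin d → ℝ => ENNReal.ofReal (∏ i, gaussianPDFReal 0 1 (z i))) *
      fun z => f (0 + Matrix.toEuclideanCLM (𝕜 := ℝ) R (WithLp.toLp 2 z))) z =
      (fun x : Fin d → ℝ => ENNReal.ofReal (∏ i, gaussianPDFReal 0 1 (R⁻¹.mulVec x i)) *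
        f (WithLp.toLp 2 x)) (Matrix.toLin' R z) := by
    intro z
    simp [Matrix.mulVec_mulVec, Matrix.nonsing_inv_mul _ hu]
  rw [lintegral_congr key, ← lintegral_map (f := fun x : Fin d → ℝ =>
      ENNReal.ofReal (∏ i, gaussianPDFReal 0 1 (R⁻¹.mulVec x i)) *
        f (WithLp.toLp 2 x)) ?_ hlin, hmvol, lintegral_smul_measure, smul_eq_mul,
    ← lintegral_const_mul']
  · refine lintegral_congr fun x => ?_
    simp only [Pi.mul_apply]
    rw [← mul_assoc, ← ENNReal.ofReal_mul (Real.sqrt_nonneg _), prod_gaussianPDFReal, hsq,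
      precisionDensity]
    congr 2
    ring
  · exact ENNReal.ofReal_ne_top
  · refine Measurable.mul (hprod.comp ?_) (hf.comp htl)
    exact (LinearMap.continuous_of_finiteDimensional (Matrix.toLin' R⁻¹)).measurable

/-! ### First two moments of Gaussian quadratic forms. -/

/-- The variance of the square of a standard Gaussian variable. -/
noncomputable def gaussianSqVariance : ℝ := Var[fun x => x ^ 2; gaussianReal 0 1]

theorem memLp_sq_gaussianReal : MemLp (fun x : ℝ => x ^ 2) 2 (gaussianReal 0 1) := by
  have h := memLp_id_gaussianReal' (μ := 0) (v := 1) 4 (by simp)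
  have := h.norm_rpow_div (q := 2)
  have e : (4 : ℝ≥0∞) / 2 = 2 := by
    rw [show (4 : ℝ≥0∞) = 2 * 2 by norm_num, ENNReal.mul_div_cancel_right (by simp) (by simp)]
  rw [e] at this
  simpa using this

theorem integral_sq_gaussianReal : ∫ x, x ^ 2 ∂(gaussianReal 0 1) = 1 := by
  have h := variance_fun_id_gaussianReal (μ := 0) (v := 1)
  rw [variance_eq_integral (by fun_prop)] at h
  simpa using h

/-- Write x = Rz with R = S^(1/2) and expand z in an eigenbasis of RAR: by rotation invariance its
coordinates are again independent standard Gaussians. Mean and variance of the form thereby reduce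
to one-dimensional moments. -/
theorem map_quadForm_multivariateGaussian {d : ℕ} {S A : Matrix (Fin d) (Fin d) ℝ}
    (hW : (CFC.sqrt S * A * CFC.sqrt S).IsHermitian) :
    (multivariateGaussian 0 S).map (quadForm A) =
      (Measure.pi fun _ : Fin d => gaussianReal 0 1).map
        fun ξ => ∑ i, hW.eigenvalues i * ξ i ^ 2 := by
  set R := CFC.sqrt S with hR
  have hRt : R.transpose = R := sqrt_transpose _
  have hq : Measurable (quadForm A) :=
    (continuous_quadForm.comp (continuous_const.prodMk continuous_id)).measurable
  have hb : Measurable fun ξ : Fin d → ℝ => ∑ i, ξ i • hW.eigenvectorBasis i := by fun_prop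
  rw [multivariateGaussian, Measure.map_map hq (by fun_prop),
    stdGaussian_eq_map_pi_orthonormalBasis hW.eigenvectorBasis,
    Measure.map_map (hq.comp (by fun_prop)) hb]
  congr 1
  ext ξ
  simp only [Function.comp_apply, zero_add]
  set x := ∑ i, ξ i • hW.eigenvectorBasis i with hx
  have h1 : quadForm A (Matrix.toEuclideanCLM (𝕜 := ℝ) R x) =
      inner ℝ x (Matrix.toEuclideanCLM (𝕜 := ℝ) (R * A * R) x) := by
    rw [quadForm_eq_dotProduct, Matrix.ofLp_toEuclideanCLM, Matrix.inner_toEuclideanCLM,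
      ← Matrix.mulVec_mulVec, ← Matrix.mulVec_mulVec, Matrix.dotProduct_mulVec x.ofLp R,
      ← Matrix.mulVec_transpose, hRt]
  have h2 : Matrix.toEuclideanCLM (𝕜 := ℝ) (R * A * R) x =
      ∑ i, (ξ i * hW.eigenvalues i) • hW.eigenvectorBasis i := by
    rw [hx, map_sum]
    refine Finset.sum_congr rfl fun i _ => ?_
    rw [map_smul, mul_smul]
    congr 1
    ext j
    simpa [Matrix.ofLp_toEuclideanCLM, Matrix.mul_assoc] using congrFun (hW.mulVec_eigenvectorBasis i) j
  rw [h1, h2, hx, hW.eigenvectorBasis.orthonormal.inner_sum]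
  exact Finset.sum_congr rfl fun i _ => by simp; ring

theorem frobSq_eq_sum_eigenvalues {d : ℕ} {W : Matrix (Fin d) (Fin d) ℝ} (hW : W.IsHermitian) :
    frobSq W = ∑ i, hW.eigenvalues i ^ 2 := by
  have ht : W.transpose = W := by
    rwa [Matrix.IsHermitian, Matrix.conjTranspose_eq_transpose_of_trivial] at hW
  have hU : star (hW.eigenvectorUnitary : Matrix (Fin d) (Fin d) ℝ) *
      (hW.eigenvectorUnitary : Matrix (Fin d) (Fin d) ℝ) = 1 := Unitary.coe_star_mul_self _
  have hd := hW.spectral_theorem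
  rw [Unitary.conjStarAlgAut_apply] at hd
  set U := (hW.eigenvectorUnitary : Matrix (Fin d) (Fin d) ℝ)
  set D : Matrix (Fin d) (Fin d) ℝ := Matrix.diagonal (RCLike.ofReal ∘ hW.eigenvalues) with hD
  have h2 : W * W = U * (D * D) * star U := by
    calc W * W = (U * D * star U) * (U * D * star U) := by rw [← hd]
      _ = U * D * (star U * U) * D * star U := by simp only [Matrix.mul_assoc]
      _ = _ := by rw [hU, Matrix.mul_one, Matrix.mul_assoc U D D]
  rw [frobSq_eq_trace, ht, h2, Matrix.trace_mul_comm, ← Matrix.mul_assoc, hU, Matrix.one_mul, hD,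
    Matrix.diagonal_mul_diagonal, Matrix.trace_diagonal]
  simp [sq]

section QuadraticMoments

variable {d : ℕ} {S : Matrix (Fin d) (Fin d) ℝ}

theorem measurable_quadForm (A : Matrix (Fin d) (Fin d) ℝ) : Measurable (quadForm A) :=
  (continuous_quadForm.comp (continuous_const.prodMk continuous_id)).measurable

theorem aemeasurable_sum_mul_sq (l : Fin d → ℝ) :
    AEMeasurable (fun ξ : Fin d → ℝ => ∑ i, l i * ξ i ^ 2)
      (Measure.pi fun _ => gaussianReal 0 1) :=
  (Finset.measurable_sum _ fun i _ => ((measurable_pi_apply i).pow_const 2).const_mul _).aemeasurable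

theorem memLp_sum_mul_sq (l : Fin d → ℝ) :
    MemLp (fun ξ : Fin d → ℝ => ∑ i, l i * ξ i ^ 2) 2 (Measure.pi fun _ => gaussianReal 0 1) :=
  memLp_finsetSum _ fun i _ => MemLp.const_mul
    (memLp_sq_gaussianReal.comp_measurePreserving
      (measurePreserving_eval (fun _ : Fin d => gaussianReal 0 1) i)) (l i)

theorem isHermitian_sqrt_mul_symPart_mul_sqrt (A : Matrix (Fin d) (Fin d) ℝ) :
    (CFC.sqrt S * symPart A * CFC.sqrt S).IsHermitian := by
  rw [Matrix.IsHermitian, Matrix.conjTranspose_eq_transpose_of_trivial, Matrix.transpose_mul,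
    Matrix.transpose_mul, sqrt_transpose, symPart_transpose, Matrix.mul_assoc]

theorem memLp_quadForm (A : Matrix (Fin d) (Fin d) ℝ) :
    MemLp (quadForm A) 2 (multivariateGaussian 0 S) := by
  have hW := isHermitian_sqrt_mul_symPart_mul_sqrt (S := S) A
  have h1 : quadForm A = quadForm (symPart A) := funext fun x => (quadForm_symPart A x).symm
  have h := (memLp_map_measure_iff (f := quadForm (symPart A)) (g := (id : ℝ → ℝ)) (p := 2)
    (μ := multivariateGaussian 0 S) aestronglyMeasurable_id (measurable_quadForm _).aemeasurable).1
  rw [h1]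
  apply h
  rw [map_quadForm_multivariateGaussian hW]
  rw [memLp_map_measure_iff aestronglyMeasurable_id (aemeasurable_sum_mul_sq _)]
  exact memLp_sum_mul_sq _

theorem integral_quadForm (h0 : 0 ≤ S) (A : Matrix (Fin d) (Fin d) ℝ) :
    ∫ x, quadForm A x ∂(multivariateGaussian 0 S) = ∑ i, ∑ j, A i j * S i j := by
  have hW := isHermitian_sqrt_mul_symPart_mul_sqrt (S := S) A
  have hSt : S.transpose = S := by
    have := (Matrix.nonneg_iff_posSemidef.1 h0).isHermitian
    rwa [Matrix.IsHermitian, Matrix.conjTranspose_eq_transpose_of_trivial] at this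
  have h1 : ∫ x, quadForm A x ∂(multivariateGaussian 0 S) =
      ∫ t, t ∂((multivariateGaussian 0 S).map (quadForm (symPart A))) := by
    rw [integral_map (f := fun t : ℝ => t) (measurable_quadForm _).aemeasurable
      aestronglyMeasurable_id]
    simp only [quadForm_symPart]
  rw [h1, map_quadForm_multivariateGaussian hW,
    integral_map (f := fun t : ℝ => t) (aemeasurable_sum_mul_sq _) aestronglyMeasurable_id,
    integral_finsetSum]
  · have : ∀ i, ∫ ξ : Fin d → ℝ, hW.eigenvalues i * ξ i ^ 2 ∂(Measure.pi fun _ => gaussianReal 0 1)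
        = hW.eigenvalues i := fun i => by
      rw [integral_const_mul, integral_comp_eval (μ := fun _ : Fin d => gaussianReal 0 1)
        (f := fun x : ℝ => x ^ 2) (by fun_prop), integral_sq_gaussianReal, mul_one]
    simp only [this]
    have ht := hW.trace_eq_sum_eigenvalues
    simp only [RCLike.ofReal_real_eq_id, id] at ht
    rw [← ht, ← sum_symPart_mul A hSt, sum_sum_mul_eq_trace, symPart_transpose, Matrix.mul_assoc,
      Matrix.trace_mul_comm, Matrix.mul_assoc, CFC.sqrt_mul_sqrt_self S h0]
  · intro i _
    exact (((memLp_sq_gaussianReal.comp_measurePreserving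
      (measurePreserving_eval (fun _ : Fin d => gaussianReal 0 1) i)).integrable
        one_le_two).const_mul _)

/-- The variance of ∑ λ_i ξ_i² is a constant times ∑ λ_i² = ‖RAR‖_F², and S ≤ 2I bounds this by
4‖A‖_F². Only the symmetric part of A is seen by the form, and symmetrizing does not increase the
norm. -/
theorem integral_quadForm_sub_sq_le (h0 : 0 ≤ S) (h2 : S ≤ (2 : ℝ) • 1)
    (A : Matrix (Fin d) (Fin d) ℝ) :
    ∫ x, (quadForm A x - ∑ i, ∑ j, A i j * S i j) ^ 2 ∂(multivariateGaussian 0 S) ≤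
      4 * gaussianSqVariance * frobSq A := by
  have hW := isHermitian_sqrt_mul_symPart_mul_sqrt (S := S) A
  rw [← integral_quadForm h0 A, ← variance_eq_integral (measurable_quadForm A).aemeasurable]
  have h1 : quadForm A = quadForm (symPart A) := funext fun x => (quadForm_symPart A x).symm
  have h3 : Var[quadForm A; multivariateGaussian 0 S] =
      Var[id; (multivariateGaussian 0 S).map (quadForm (symPart A))] := by
    rw [variance_map aemeasurable_id (measurable_quadForm _).aemeasurable, h1]; rfl
  have h4 : Var[quadForm A; multivariateGaussian 0 S] =
      gaussianSqVariance * frobSq (CFC.sqrt S * symPart A * CFC.sqrt S) := by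
    rw [h3, map_quadForm_multivariateGaussian hW, variance_map aemeasurable_id (aemeasurable_sum_mul_sq _)]
    have e : (id ∘ fun ξ : Fin d → ℝ => ∑ i, hW.eigenvalues i * ξ i ^ 2) =
        ∑ i, fun ξ : Fin d → ℝ => (fun x : ℝ => hW.eigenvalues i * x ^ 2) (ξ i) := by
      ext ξ; simp
    rw [e, variance_sum_pi (μ := fun _ : Fin d => gaussianReal 0 1)
      (fun i => memLp_sq_gaussianReal.const_mul _), frobSq_eq_sum_eigenvalues hW, Finset.mul_sum]
    refine Finset.sum_congr rfl fun i _ => ?_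
    rw [variance_const_mul, gaussianSqVariance, mul_comm]
  rw [h4]
  have hv : 0 ≤ gaussianSqVariance := variance_nonneg _ _
  have := (frobSq_sqrt_mul_mul_sqrt_le h0 h2 (symPart A)).trans
    (mul_le_mul_of_nonneg_left (frobSq_symPart_le A) (by norm_num))
  nlinarith

end QuadraticMoments

/-! ### Elementary bounds for Frobenius norms and quadratic forms. -/

theorem frobSq_add_le {d : ℕ} (A B : Matrix (Fin d) (Fin d) ℝ) :
    frobSq (A + B) ≤ 2 * frobSq A + 2 * frobSq B := by
  simp only [frobSq, Matrix.add_apply, Finset.mul_sum, ← Finset.sum_add_distrib]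
  exact Finset.sum_le_sum fun i _ => Finset.sum_le_sum fun j _ => by
    nlinarith [sq_nonneg (A i j - B i j)]

theorem frobSq_smul {d : ℕ} (c : ℝ) (A : Matrix (Fin d) (Fin d) ℝ) :
    frobSq (c • A) = c ^ 2 * frobSq A := by
  simp [frobSq, Finset.mul_sum, mul_pow]

theorem sq_apply_le_frobSq {d : ℕ} (A : Matrix (Fin d) (Fin d) ℝ) (i j : Fin d) :
    A i j ^ 2 ≤ frobSq A :=
  (Finset.single_le_sum (f := fun j => A i j ^ 2) (fun _ _ => sq_nonneg _)
    (Finset.mem_univ j)).trans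
  (Finset.single_le_sum (f := fun i => ∑ j, A i j ^ 2)
    (fun _ _ => Finset.sum_nonneg fun _ _ => sq_nonneg _) (Finset.mem_univ i))

theorem sum_sum_mul_sq_le {d : ℕ} (A B : Matrix (Fin d) (Fin d) ℝ) :
    (∑ i, ∑ j, A i j * B i j) ^ 2 ≤ frobSq A * frobSq B := by
  simp only [frobSq, ← Fintype.sum_prod_type']
  exact Finset.sum_mul_sq_le_sq_mul_sq _ (fun p : Fin d × Fin d => A p.1 p.2) fun p => B p.1 p.2

theorem quadForm_sq_le {d : ℕ} (A : Matrix (Fin d) (Fin d) ℝ) (x : EuclideanSpace ℝ (Fin d)) :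
    quadForm A x ^ 2 ≤ frobSq A * (∑ i, x i ^ 2) ^ 2 := by
  refine (sum_sum_mul_sq_le A (Matrix.of fun i j => x i * x j)).trans (le_of_eq ?_)
  congr 1
  simp [frobSq, sq, Finset.sum_mul_sum, mul_mul_mul_comm]

theorem abs_quadForm_le {d : ℕ} {A : Matrix (Fin d) (Fin d) ℝ} {c : ℝ} (hc : 0 ≤ c)
    (h : frobSq A ≤ c ^ 2) (x : EuclideanSpace ℝ (Fin d)) :
    |quadForm A x| ≤ c * ∑ i, x i ^ 2 := by
  have h0 : 0 ≤ ∑ i, x i ^ 2 := Finset.sum_nonneg fun _ _ => sq_nonneg _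
  refine abs_le_of_sq_le_sq ?_ (mul_nonneg hc h0)
  rw [mul_pow]
  exact (quadForm_sq_le A x).trans (mul_le_mul_of_nonneg_right h (sq_nonneg _))

theorem quadForm_add {d : ℕ} (A B : Matrix (Fin d) (Fin d) ℝ) (x : EuclideanSpace ℝ (Fin d)) :
    quadForm (A + B) x = quadForm A x + quadForm B x := by
  simp [quadForm, add_mul, Finset.sum_add_distrib]

theorem quadForm_smul {d : ℕ} (c : ℝ) (A : Matrix (Fin d) (Fin d) ℝ)
    (x : EuclideanSpace ℝ (Fin d)) : quadForm (c • A) x = c * quadForm A x := by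
  simp [quadForm, Finset.mul_sum, mul_assoc]

theorem quadForm_one {d : ℕ} (x : EuclideanSpace ℝ (Fin d)) : quadForm 1 x = ∑ i, x i ^ 2 := by
  simp [quadForm, Matrix.one_apply, sq]

theorem posSemidef_of_quadForm_nonneg {d : ℕ} {A : Matrix (Fin d) (Fin d) ℝ}
    (hA : A.transpose = A) (h : ∀ x, 0 ≤ quadForm A x) : A.PosSemidef := by
  refine Matrix.PosSemidef.of_dotProduct_mulVec_nonneg ?_ fun x => ?_
  · rwa [Matrix.IsHermitian, Matrix.conjTranspose_eq_transpose_of_trivial]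
  · simpa [quadForm_eq_dotProduct] using h (WithLp.toLp 2 x)

/-! ### The parametrized family of covariance matrices. -/

/-- The precision matrix `(3/4) I + (θ + θᵀ)/2` with parameter `θ`. -/
noncomputable def precMat {d : ℕ} (θ : Fin d × Fin d → ℝ) : Matrix (Fin d) (Fin d) ℝ :=
  (3 / 4 : ℝ) • 1 + symPart (Matrix.of fun i j => θ (i, j))

/-- The covariance matrix with parameter `θ`. -/
noncomputable def covMat {d : ℕ} (θ : Fin d × Fin d → ℝ) : Matrix (Fin d) (Fin d) ℝ :=
  (precMat θ)⁻¹

/-- The score of the Gaussian with parameter `θ` in the direction of the entry `a`. -/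
noncomputable def score {d : ℕ} (θ : Fin d × Fin d → ℝ) (a : Fin d × Fin d)
    (x : EuclideanSpace ℝ (Fin d)) : ℝ :=
  (covMat θ a.1 a.2 - x a.1 * x a.2) / 2

/-- The set of parameters with all entries in `[-1/(4d), 1/(4d)]`. -/
def cube (d : ℕ) : Set (Fin d × Fin d → ℝ) :=
  {θ | ∀ a, θ a ∈ Set.Icc (-(1 / (4 * d : ℝ))) (1 / (4 * d : ℝ))}

section Cube

variable {d : ℕ} {θ : Fin d × Fin d → ℝ}

/-- The side 1/(4d) of the cube makes ‖θ‖_F ≤ 1/4, hence P stays between (3/4 - 1/4)I and (3/4 +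
1/4)I, whatever the signs of the entries. -/
theorem frobSq_param_le (hd : 1 ≤ d) (hθ : θ ∈ cube d) :
    frobSq (Matrix.of fun i j => θ (i, j)) ≤ (1 / 4) ^ 2 := by
  have hd' : (0 : ℝ) < d := by exact_mod_cast hd
  calc frobSq (Matrix.of fun i j => θ (i, j))
      ≤ ∑ _i : Fin d, ∑ _j : Fin d, (1 / (4 * d : ℝ)) ^ 2 :=
        Finset.sum_le_sum fun i _ => Finset.sum_le_sum fun j _ => by
          have := hθ (i, j)
          exact sq_le_sq' this.1 this.2
    _ = (1 / 4) ^ 2 := by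
        simp only [Finset.sum_const, Finset.card_univ, Fintype.card_fin, nsmul_eq_mul]
        field_simp

theorem precMat_transpose (θ : Fin d × Fin d → ℝ) : (precMat θ).transpose = precMat θ := by
  simp [precMat, symPart_transpose]

theorem covMat_transpose (θ : Fin d × Fin d → ℝ) : (covMat θ).transpose = covMat θ := by
  rw [covMat, Matrix.transpose_nonsing_inv, precMat_transpose]

theorem quadForm_precMat (θ : Fin d × Fin d → ℝ) (x : EuclideanSpace ℝ (Fin d)) :
    quadForm (precMat θ) x =
      3 / 4 * ∑ i, x i ^ 2 + quadForm (Matrix.of fun i j => θ (i, j)) x := by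
  rw [precMat, quadForm_add, quadForm_smul, quadForm_one, quadForm_symPart]

theorem precMat_le_one (hd : 1 ≤ d) (hθ : θ ∈ cube d) : precMat θ ≤ 1 := by
  rw [Matrix.le_iff]
  refine posSemidef_of_quadForm_nonneg (by simp [precMat_transpose]) fun x => ?_
  have h := abs_le.1 (abs_quadForm_le (by norm_num) (frobSq_param_le hd hθ) x)
  have e : (1 : Matrix (Fin d) (Fin d) ℝ) - precMat θ = 1 + (-1 : ℝ) • precMat θ := by
    rw [neg_one_smul, sub_eq_add_neg]
  rw [e, quadForm_add, quadForm_smul, quadForm_one, quadForm_precMat]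
  linarith [h.2]

theorem half_le_precMat (hd : 1 ≤ d) (hθ : θ ∈ cube d) : (1 / 2 : ℝ) • 1 ≤ precMat θ := by
  rw [Matrix.le_iff]
  refine posSemidef_of_quadForm_nonneg (by simp [precMat_transpose]) fun x => ?_
  have h := abs_le.1 (abs_quadForm_le (by norm_num) (frobSq_param_le hd hθ) x)
  have e : precMat θ - (1 / 2 : ℝ) • (1 : Matrix (Fin d) (Fin d) ℝ) =
      precMat θ + (-1 / 2 : ℝ) • 1 := by
    rw [sub_eq_add_neg, ← neg_smul, neg_div]
  rw [e, quadForm_add, quadForm_smul, quadForm_one, quadForm_precMat]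
  linarith [h.1]

theorem posDef_precMat (hd : 1 ≤ d) (hθ : θ ∈ cube d) : (precMat θ).PosDef := by
  have h1 : ((1 / 2 : ℝ) • (1 : Matrix (Fin d) (Fin d) ℝ)).PosDef :=
    Matrix.PosDef.one.smul (by norm_num)
  simpa using h1.add_posSemidef (Matrix.le_iff.1 (half_le_precMat hd hθ))

theorem isUnit_det_precMat (hd : 1 ≤ d) (hθ : θ ∈ cube d) : IsUnit (precMat θ).det :=
  isUnit_iff_ne_zero.2 (posDef_precMat hd hθ).det_pos.ne'

/-- Conjugation by Σ^(1/2) sends P to I and I to Σ, so it turns I/2 ≤ P ≤ I into I ≤ Σ ≤ 2I. -/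
theorem sqrt_covMat_mul_precMat_mul (hd : 1 ≤ d) (hθ : θ ∈ cube d) :
    CFC.sqrt (covMat θ) * precMat θ * CFC.sqrt (covMat θ) = 1 := by
  have hS : (covMat θ).PosDef := (posDef_precMat hd hθ).inv
  have hRR := CFC.sqrt_mul_sqrt_self _ hS.posSemidef.nonneg
  have h1 : CFC.sqrt (covMat θ) * (CFC.sqrt (covMat θ) * precMat θ) = 1 := by
    rw [← Matrix.mul_assoc, hRR, covMat, Matrix.nonsing_inv_mul _ (isUnit_det_precMat hd hθ)]
  exact mul_eq_one_comm.1 h1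

theorem one_le_covMat (hd : 1 ≤ d) (hθ : θ ∈ cube d) : 1 ≤ covMat θ := by
  have hS : (covMat θ).PosDef := (posDef_precMat hd hθ).inv
  have h := (Matrix.le_iff.1 (precMat_le_one hd hθ)).conjTranspose_mul_mul_same
    (CFC.sqrt (covMat θ))
  rw [Matrix.conjTranspose_eq_transpose_of_trivial, sqrt_transpose, Matrix.mul_sub, Matrix.sub_mul,
    sqrt_covMat_mul_precMat_mul hd hθ, Matrix.mul_one,
    CFC.sqrt_mul_sqrt_self _ hS.posSemidef.nonneg] at h
  exact Matrix.le_iff.2 h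

theorem covMat_le_two (hd : 1 ≤ d) (hθ : θ ∈ cube d) : covMat θ ≤ (2 : ℝ) • 1 := by
  have hS : (covMat θ).PosDef := (posDef_precMat hd hθ).inv
  have h := ((Matrix.le_iff.1 (half_le_precMat hd hθ)).conjTranspose_mul_mul_same
    (CFC.sqrt (covMat θ))).smul (a := (2 : ℝ)) (by norm_num)
  rw [Matrix.conjTranspose_eq_transpose_of_trivial, sqrt_transpose, Matrix.mul_sub, Matrix.sub_mul,
    sqrt_covMat_mul_precMat_mul hd hθ, Matrix.mul_smul, Matrix.smul_mul, Matrix.mul_one,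
    CFC.sqrt_mul_sqrt_self _ hS.posSemidef.nonneg, smul_sub, smul_smul] at h
  norm_num at h
  exact Matrix.le_iff.2 h

theorem covMat_nonneg (hd : 1 ≤ d) (hθ : θ ∈ cube d) : 0 ≤ covMat θ :=
  zero_le_one.trans (one_le_covMat hd hθ)

theorem covMat_mul_symPart (hd : 1 ≤ d) (hθ : θ ∈ cube d) :
    covMat θ * symPart (Matrix.of fun i j => θ (i, j)) = 1 - (3 / 4 : ℝ) • covMat θ := by
  have h : covMat θ * precMat θ = 1 := Matrix.nonsing_inv_mul _ (isUnit_det_precMat hd hθ)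
  rw [precMat, Matrix.mul_add, Matrix.mul_smul, Matrix.mul_one] at h
  rw [← h]; abel

/-- With T the symmetric part of θ, ΣP = I reads ΣT = I - (3/4)Σ. Multiply by T and take traces; Σ ≥
I gives tr(TΣT) ≥ ‖T‖_F². The trace of θ has mean zero under the prior, so the quadratic term makes
the mean of ⟨θ, Σ⟩ negative. -/
theorem sum_param_mul_covMat_le (hd : 1 ≤ d) (hθ : θ ∈ cube d) :
    ∑ i, ∑ j, θ (i, j) * covMat θ i j ≤ 4 / 3 * ∑ i, θ (i, i) -
      4 / 3 * frobSq (symPart (Matrix.of fun i j => θ (i, j))) := by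
  set T : Matrix (Fin d) (Fin d) ℝ := Matrix.of fun i j => θ (i, j)
  set S := symPart T with hS
  have hSt : S.transpose = S := symPart_transpose _
  have h1 : ∑ i, ∑ j, θ (i, j) * covMat θ i j = (S * covMat θ).trace := by
    have := sum_symPart_mul T (covMat_transpose θ)
    rw [sum_sum_mul_eq_trace, symPart_transpose] at this
    exact this.symm
  have h2 := le_trace_transpose_mul_mul (one_le_covMat hd hθ) S
  rw [hSt, Matrix.mul_assoc, covMat_mul_symPart hd hθ, Matrix.mul_sub, Matrix.mul_one,
    Matrix.mul_smul, Matrix.trace_sub, Matrix.trace_smul, smul_eq_mul] at h2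
  have h3 : S.trace = ∑ i, θ (i, i) := by
    simp [Matrix.trace, hS, symPart_apply, T]
  rw [h1, ← h3]; linarith

/-- (4/3)I is the covariance at θ = 0, and Σ - (4/3)I = -(4/3)ΣT with T the symmetric part of θ and
‖T‖_F ≤ 1/4. -/
theorem frobSq_covMat_sub_le (hd : 1 ≤ d) (hθ : θ ∈ cube d) :
    frobSq (covMat θ - (4 / 3 : ℝ) • 1) ≤ 4 / 9 := by
  set S := symPart (Matrix.of fun i j => θ (i, j)) with hS
  have e : covMat θ - (4 / 3 : ℝ) • 1 = (-4 / 3 : ℝ) • (covMat θ * S) := by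
    rw [hS, covMat_mul_symPart hd hθ, smul_sub, smul_smul]; norm_num;
    rw [sub_eq_add_neg, add_comm]
  have h0 := covMat_nonneg hd hθ
  have h2 := covMat_le_two hd hθ
  have h3 : frobSq (covMat θ * S) ≤ 4 * frobSq S := by
    rw [← CFC.sqrt_mul_sqrt_self _ h0, Matrix.mul_assoc]
    linarith [frobSq_sqrt_mul_le h0 h2 (CFC.sqrt (covMat θ) * S), frobSq_sqrt_mul_le h0 h2 S]
  have h4 := (frobSq_symPart_le _).trans (frobSq_param_le hd hθ)
  rw [e, frobSq_smul]
  rw [← hS] at h4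
  linarith

end Cube

/-! ### The score as the logarithmic derivative of the density. -/

section Derivative

variable {d : ℕ}

/-- det(P + sE) = det P · det(I + sP⁻¹E), and the second factor is the polynomial 1 + s·tr(P⁻¹E) +
s²q(s). -/
theorem hasDerivAt_det_add_smul {P : Matrix (Fin d) (Fin d) ℝ} (hP : IsUnit P.det)
    (E : Matrix (Fin d) (Fin d) ℝ) :
    HasDerivAt (fun s : ℝ => (P + s • E).det) (P.det * (P⁻¹ * E).trace) 0 := by
  have h : ∀ s : ℝ, (P + s • E).det = P.det * (1 + (P⁻¹ * E).trace * s +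
      ((Matrix.det (1 + (Polynomial.X : Polynomial ℝ) • (P⁻¹ * E).map Polynomial.C)).divX.divX.eval s) * s ^ 2) := by
    intro s
    rw [← Matrix.det_one_add_smul, ← Matrix.det_mul, Matrix.mul_add, Matrix.mul_one,
      Matrix.mul_smul, Matrix.mul_nonsing_inv_cancel_left _ _ hP]
  simp only [h]
  set p := (Matrix.det (1 + (Polynomial.X : Polynomial ℝ) • (P⁻¹ * E).map Polynomial.C)).divX.divX
  have h1 : HasDerivAt (fun s : ℝ => (P⁻¹ * E).trace * s) ((P⁻¹ * E).trace) 0 := by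
    simpa using (hasDerivAt_id (0:ℝ)).const_mul (P⁻¹ * E).trace
  have h2 : HasDerivAt (fun s : ℝ => p.eval s * s ^ 2) 0 0 := by
    simpa [Pi.mul_def] using (p.hasDerivAt 0).mul (hasDerivAt_pow 2 (0:ℝ))
  simpa using ((h1.const_add 1).add h2).const_mul P.det

theorem precMat_update (θ : Fin d × Fin d → ℝ) (a : Fin d × Fin d) (t s : ℝ) :
    precMat (Function.update θ a (t + s)) = precMat (Function.update θ a t) +
      s • symPart (Matrix.single a.1 a.2 (1 : ℝ)) := by
  obtain ⟨k, l⟩ := a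
  ext i j
  simp only [precMat, Matrix.add_apply, Matrix.smul_apply, symPart_apply, Matrix.of_apply,
    Function.update_apply, Matrix.single_apply, Prod.mk.injEq, smul_eq_mul]
  have c1 : (i = k ∧ j = l) ↔ (k = i ∧ l = j) := by constructor <;> (rintro ⟨rfl, rfl⟩; simp)
  have c2 : (j = k ∧ i = l) ↔ (k = j ∧ l = i) := by constructor <;> (rintro ⟨rfl, rfl⟩; simp)
  simp only [c1, c2]
  split_ifs <;> ring

theorem trace_mul_symPart_single {S : Matrix (Fin d) (Fin d) ℝ} (hS : S.transpose = S)
    (i j : Fin d) : (S * symPart (Matrix.single i j (1 : ℝ))).trace = S i j := by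
  have h := sum_symPart_mul (Matrix.single i j (1 : ℝ)) hS
  rw [sum_sum_mul_eq_trace, symPart_transpose, Matrix.trace_mul_comm] at h
  rw [h]
  simp [Matrix.single_apply, ite_and]

theorem quadForm_symPart_single (i j : Fin d) (x : EuclideanSpace ℝ (Fin d)) :
    quadForm (symPart (Matrix.single i j (1 : ℝ))) x = x i * x j := by
  rw [quadForm_symPart]
  simp [quadForm, Matrix.single_apply, ite_and]

theorem hasDerivAt_precisionDensity {θ : Fin d × Fin d → ℝ} (a : Fin d × Fin d) {t : ℝ}
    (hP : (precMat (Function.update θ a t)).PosDef) (x : EuclideanSpace ℝ (Fin d)) :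
    HasDerivAt (fun t => precisionDensity (precMat (Function.update θ a t)) x)
      (score (Function.update θ a t) a x *
        precisionDensity (precMat (Function.update θ a t)) x) t := by
  suffices h : HasDerivAt (fun s => precisionDensity (precMat (Function.update θ a (t + s))) x)
      (score (Function.update θ a t) a x *
        precisionDensity (precMat (Function.update θ a t)) x) 0 by
    have h' := HasDerivAt.comp_sub_const t t (by simpa using h)
    simpa using h'
  set P := precMat (Function.update θ a t) with hPdef
  set E := symPart (Matrix.single a.1 a.2 (1 : ℝ)) with hE
  simp only [precMat_update]
  rw [← hPdef, ← hE]
  have hdet := hasDerivAt_det_add_smul (isUnit_iff_ne_zero.2 hP.det_pos.ne') E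
  have hsq : HasDerivAt (fun s : ℝ => √(P + s • E).det)
      (√P.det * (P⁻¹ * E).trace / 2) 0 := by
    have h := hdet.sqrt (by simpa using hP.det_pos.ne')
    convert h using 1
    simp only [zero_smul, add_zero]
    have h0 : √P.det ≠ 0 := (Real.sqrt_pos.2 hP.det_pos).ne'
    field_simp
    rw [Real.sq_sqrt hP.det_pos.le, mul_comm]
  have hex : HasDerivAt (fun s : ℝ => Real.exp (-(quadForm (P + s • E) x) / 2))
      (Real.exp (-(quadForm P x) / 2) * (-(quadForm E x) / 2)) 0 := by
    have h : HasDerivAt (fun s : ℝ => -(quadForm (P + s • E) x) / 2) (-(quadForm E x) / 2) 0 := by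
      simp only [quadForm_add, quadForm_smul]
      have := (((hasDerivAt_id (0 : ℝ)).mul_const (quadForm E x)).const_add (quadForm P x)).neg.div_const 2
      simpa using this
    simpa using h.exp
  have h := ((hsq.const_mul ((√(2 * Real.pi))⁻¹ ^ d)).mul hex)
  unfold precisionDensity
  refine h.congr_deriv ?_
  have e1 : (P⁻¹ * E).trace = P⁻¹ a.1 a.2 :=
    trace_mul_symPart_single (covMat_transpose (Function.update θ a t)) _ _
  rw [e1]
  simp only [zero_smul, add_zero, hE, quadForm_symPart_single, score, covMat]
  rw [← hPdef]
  ring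

theorem hasDerivAt_prod_precisionDensity {n : ℕ} {θ : Fin d × Fin d → ℝ} (a : Fin d × Fin d)
    {t : ℝ} (hP : (precMat (Function.update θ a t)).PosDef) (X : Dataset n d) :
    HasDerivAt (fun t => ∏ k, precisionDensity (precMat (Function.update θ a t)) (X k))
      ((∑ k, score (Function.update θ a t) a (X k)) *
        ∏ k, precisionDensity (precMat (Function.update θ a t)) (X k)) t := by
  have h := HasDerivAt.fun_finsetProd (u := Finset.univ)
    (f := fun k t => precisionDensity (precMat (Function.update θ a t)) (X k))
    fun k _ => hasDerivAt_precisionDensity a hP (X k)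
  refine h.congr_deriv ?_
  rw [Finset.sum_mul]
  refine Finset.sum_congr rfl fun k _ => ?_
  rw [← Finset.prod_erase_mul _ _ (Finset.mem_univ k), smul_eq_mul]
  ring

theorem continuous_precMat : Continuous (precMat : (Fin d × Fin d → ℝ) → _) := by
  refine continuous_matrix fun i j => ?_
  simp only [precMat, Matrix.add_apply, symPart_apply, Matrix.of_apply]
  fun_prop

theorem continuousOn_covMat_apply (i j : Fin d) :
    ContinuousOn (fun θ : Fin d × Fin d → ℝ => covMat θ i j) {θ | (precMat θ).det ≠ 0} := by
  have h : (fun θ : Fin d × Fin d → ℝ => covMat θ i j) =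
      fun θ => ((precMat θ).det)⁻¹ * (precMat θ).adjugate i j := by
    ext θ; simp [covMat, Matrix.inv_def]
  rw [h]
  refine ContinuousOn.mul (ContinuousOn.inv₀ continuous_precMat.matrix_det.continuousOn
    fun θ hθ => hθ) ?_
  exact (continuous_precMat.matrix_adjugate.matrix_elem i j).continuousOn

theorem measurable_covMat_apply (i j : Fin d) :
    Measurable (fun θ : Fin d × Fin d → ℝ => covMat θ i j) := by
  have h : (fun θ : Fin d × Fin d → ℝ => covMat θ i j) =
      fun θ => ((precMat θ).det)⁻¹ * (precMat θ).adjugate i j := by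
    ext θ; simp [covMat, Matrix.inv_def]
  rw [h]
  exact continuous_precMat.matrix_det.measurable.inv.mul
    (continuous_precMat.matrix_adjugate.matrix_elem i j).measurable

end Derivative

/-! ### Samples, their joint density, and moments of the score. -/

section Model

variable {d : ℕ} {θ : Fin d × Fin d → ℝ}

/-- The joint density of `n` independent samples with precision matrix `P`. -/
noncomputable def sampleDensity {n d : ℕ} (P : Matrix (Fin d) (Fin d) ℝ) (X : Dataset n d) : ℝ :=
  ∏ k, precisionDensity P (X k)

theorem sampleDensity_nonneg {n : ℕ} (P : Matrix (Fin d) (Fin d) ℝ) (X : Dataset n d) :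
    0 ≤ sampleDensity P X := Finset.prod_nonneg fun _ _ => precisionDensity_nonneg _ _

theorem continuous_sampleDensity {n : ℕ} : Continuous
    fun p : Matrix (Fin d) (Fin d) ℝ × Dataset n d => sampleDensity p.1 p.2 :=
  continuous_finsetProd _ fun k _ => continuous_precisionDensity.comp
    (continuous_fst.prodMk ((continuous_apply k).comp continuous_snd))

theorem integrable_precisionDensity {P : Matrix (Fin d) (Fin d) ℝ} (hP : P.PosDef) :
    Integrable (precisionDensity P) volume := by
  have hm : Measurable (precisionDensity P) :=
    (continuous_precisionDensity.comp (continuous_const.prodMk continuous_id)).measurable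
  refine (lintegral_ofReal_ne_top_iff_integrable hm.aestronglyMeasurable
    (.of_forall (precisionDensity_nonneg P))).1 ?_
  have h : (multivariateGaussian 0 P⁻¹ : Measure (EuclideanSpace ℝ (Fin d))) Set.univ = 1 :=
    measure_univ
  rw [multivariateGaussian_inv_eq_withDensity hP, withDensity_apply _ MeasurableSet.univ,
    Measure.restrict_univ] at h
  simp [h]

theorem gaussianSamples_inv {n : ℕ} {P : Matrix (Fin d) (Fin d) ℝ} (hP : P.PosDef) :
    gaussianSamples n P⁻¹ =
      (volume : Measure (Dataset n d)).withDensity fun X => ENNReal.ofReal (sampleDensity P X) := by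
  rw [gaussianSamples, multivariateGaussian_inv_eq_withDensity hP]
  exact pi_withDensity_ofReal _ (precisionDensity_nonneg P) (integrable_precisionDensity hP)

instance isProbabilityMeasure_gaussianSamples (n : ℕ) (S : Matrix (Fin d) (Fin d) ℝ) :
    IsProbabilityMeasure (gaussianSamples n S) := by
  unfold gaussianSamples; infer_instance

theorem measurable_sampleDensity {n : ℕ} (P : Matrix (Fin d) (Fin d) ℝ) :
    Measurable (sampleDensity (n := n) P) :=
  (continuous_sampleDensity.comp (continuous_const.prodMk continuous_id)).measurable

theorem integral_gaussianSamples_inv {n : ℕ} {P : Matrix (Fin d) (Fin d) ℝ} (hP : P.PosDef)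
    (f : Dataset n d → ℝ) :
    ∫ X, f X ∂(gaussianSamples n P⁻¹) = ∫ X, sampleDensity P X * f X := by
  rw [gaussianSamples_inv hP, integral_withDensity_eq_integral_toReal_smul
    (measurable_sampleDensity P).ennreal_ofReal (.of_forall fun _ => ENNReal.ofReal_lt_top)]
  simp [ENNReal.toReal_ofReal (sampleDensity_nonneg P _)]

theorem integrable_gaussianSamples_inv {n : ℕ} {P : Matrix (Fin d) (Fin d) ℝ} (hP : P.PosDef)
    {f : Dataset n d → ℝ} :
    Integrable f (gaussianSamples n P⁻¹) ↔ Integrable fun X => sampleDensity P X * f X := by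
  rw [gaussianSamples_inv hP, integrable_withDensity_iff_integrable_smul'
    (measurable_sampleDensity P).ennreal_ofReal (.of_forall fun _ => ENNReal.ofReal_lt_top)]
  simp [ENNReal.toReal_ofReal (sampleDensity_nonneg P _)]

theorem sum_mul_score (U : Matrix (Fin d) (Fin d) ℝ) (x : EuclideanSpace ℝ (Fin d)) :
    ∑ a, U a.1 a.2 * score θ a x =
      (∑ i, ∑ j, U i j * covMat θ i j - quadForm U x) / 2 := by
  rw [Fintype.sum_prod_type, quadForm, ← Finset.sum_sub_distrib, Finset.sum_div]
  refine Finset.sum_congr rfl fun i _ => ?_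
  rw [← Finset.sum_sub_distrib, Finset.sum_div]
  refine Finset.sum_congr rfl fun j _ => ?_
  simp only [score]; ring

theorem score_eq (θ : Fin d × Fin d → ℝ) (a : Fin d × Fin d) (x : EuclideanSpace ℝ (Fin d)) :
    score θ a x = (covMat θ a.1 a.2 - quadForm (symPart (Matrix.single a.1 a.2 1)) x) / 2 := by
  rw [quadForm_symPart_single, score]

theorem integrable_score (S : Matrix (Fin d) (Fin d) ℝ) (θ : Fin d × Fin d → ℝ) (a : Fin d × Fin d) :
    Integrable (score θ a) (multivariateGaussian 0 S) := by
  have : score θ a = fun x => (covMat θ a.1 a.2 -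
      quadForm (symPart (Matrix.single a.1 a.2 1)) x) / 2 := funext (score_eq θ a)
  rw [this]
  exact ((integrable_const _).sub ((memLp_quadForm _).integrable one_le_two)).div_const 2

theorem integral_score (hd : 1 ≤ d) (hθ : θ ∈ cube d) (a : Fin d × Fin d) :
    ∫ x, score θ a x ∂(multivariateGaussian 0 (covMat θ)) = 0 := by
  simp only [score_eq]
  rw [integral_div, integral_sub (integrable_const _) ((memLp_quadForm _).integrable one_le_two),
    integral_quadForm (covMat_nonneg hd hθ), sum_sum_mul_eq_trace, symPart_transpose,
    Matrix.trace_mul_comm, trace_mul_symPart_single (covMat_transpose θ)]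
  simp

theorem frobSq_one : frobSq (1 : Matrix (Fin d) (Fin d) ℝ) = d := by
  simp [frobSq, Matrix.one_apply]

theorem frobSq_covMat_le (hd : 1 ≤ d) (hθ : θ ∈ cube d) : frobSq (covMat θ) ≤ (2 * d) ^ 2 := by
  have hd' : (1 : ℝ) ≤ d := by exact_mod_cast hd
  have h := frobSq_sqrt_mul_mul_sqrt_le (covMat_nonneg hd hθ) (covMat_le_two hd hθ) 1
  rw [Matrix.mul_one, CFC.sqrt_mul_sqrt_self _ (covMat_nonneg hd hθ), frobSq_one] at h
  nlinarith

theorem trace_covMat_le (hd : 1 ≤ d) (hθ : θ ∈ cube d) :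
    ∑ i, ∑ j, (1 : Matrix (Fin d) (Fin d) ℝ) i j * covMat θ i j ≤ 2 * d := by
  have h := trace_transpose_mul_mul_le (covMat_le_two hd hθ) 1
  rw [frobSq_one, Matrix.mul_one, ← sum_sum_mul_eq_trace] at h
  exact h

theorem integrable_sum_sq (S : Matrix (Fin d) (Fin d) ℝ) :
    MemLp (fun x : EuclideanSpace ℝ (Fin d) => ∑ i, x i ^ 2) 2 (multivariateGaussian 0 S) := by
  simp only [← quadForm_one]
  exact memLp_quadForm 1

theorem integral_sum_sq_le (hd : 1 ≤ d) (hθ : θ ∈ cube d) :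
    ∫ x : EuclideanSpace ℝ (Fin d), ∑ i, x i ^ 2 ∂(multivariateGaussian 0 (covMat θ)) ≤ 2 * d := by
  simp only [← quadForm_one]
  rw [integral_quadForm (covMat_nonneg hd hθ)]
  exact trace_covMat_le hd hθ

/-- A crude bound, needed only for integrability; the sharp estimates go through the variance of
quadratic forms. -/
theorem abs_score_le (hd : 1 ≤ d) (hθ : θ ∈ cube d) (a : Fin d × Fin d)
    (x : EuclideanSpace ℝ (Fin d)) : |score θ a x| ≤ d + ∑ i, x i ^ 2 := by
  have h1 : |covMat θ a.1 a.2| ≤ 2 * d := abs_le_of_sq_le_sq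
    ((sq_apply_le_frobSq _ _ _).trans (frobSq_covMat_le hd hθ)) (by positivity)
  have hs : ∀ i, x i ^ 2 ≤ ∑ i, x i ^ 2 := fun i =>
    Finset.single_le_sum (f := fun i => x i ^ 2) (fun _ _ => sq_nonneg _) (Finset.mem_univ i)
  have h2 : |x a.1 * x a.2| ≤ ∑ i, x i ^ 2 := by
    rw [abs_le]
    constructor <;> nlinarith [hs a.1, hs a.2, sq_nonneg (x a.1 + x a.2), sq_nonneg (x a.1 - x a.2)]
  have h0 : 0 ≤ ∑ i, x i ^ 2 := Finset.sum_nonneg fun _ _ => sq_nonneg _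
  rw [score, abs_le]
  rw [abs_le] at h1 h2
  constructor <;> linarith [h1.1, h1.2, h2.1, h2.2]

end Model

/-! ### The product prior on the cube of parameters. -/

section Prior

/-- The uniform distribution on `[-1/(4d), 1/(4d)]`. -/
noncomputable def coordPrior (d : ℕ) : Measure ℝ :=
  cond volume (Set.Icc (-(1 / (4 * d : ℝ))) (1 / (4 * d : ℝ)))

/-- The uniform distribution on the cube of parameters. -/
noncomputable def paramPrior (d : ℕ) : Measure (Fin d × Fin d → ℝ) :=
  Measure.pi fun _ => coordPrior d

variable {d : ℕ}

theorem isProbabilityMeasure_coordPrior (hd : 1 ≤ d) : IsProbabilityMeasure (coordPrior d) := by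
  have hd' : (0 : ℝ) < d := by exact_mod_cast hd
  have hr : 0 < 1 / (4 * d : ℝ) := by positivity
  refine cond_isProbabilityMeasure_of_finite ?_ ?_
  · rw [Real.volume_Icc]; simp only [ne_eq, ENNReal.ofReal_eq_zero, not_le]; linarith
  · rw [Real.volume_Icc]; exact ENNReal.ofReal_ne_top

theorem isProbabilityMeasure_paramPrior (hd : 1 ≤ d) : IsProbabilityMeasure (paramPrior d) := by
  have := isProbabilityMeasure_coordPrior hd
  unfold paramPrior; infer_instance

theorem ae_coordPrior_mem (d : ℕ) :
    ∀ᵐ t ∂(coordPrior d), t ∈ Set.Icc (-(1 / (4 * d : ℝ))) (1 / (4 * d : ℝ)) :=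
  ae_cond_mem measurableSet_Icc

theorem ae_paramPrior_mem_cube (hd : 1 ≤ d) : ∀ᵐ θ ∂(paramPrior d), θ ∈ cube d := by
  have := isProbabilityMeasure_coordPrior hd
  refine ae_all_iff.2 fun a => ?_
  exact (measurePreserving_eval (fun _ : Fin d × Fin d => coordPrior d)
    a).quasiMeasurePreserving.ae (ae_coordPrior_mem d)

theorem update_mem_cube {θ : Fin d × Fin d → ℝ} (hθ : θ ∈ cube d) (a : Fin d × Fin d) {t : ℝ}
    (ht : t ∈ Set.Icc (-(1 / (4 * d : ℝ))) (1 / (4 * d : ℝ))) : Function.update θ a t ∈ cube d := by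
  intro b
  by_cases h : b = a
  · subst h; simpa using ht
  · simpa [Function.update_of_ne h] using hθ b

theorem integral_coordPrior_eq {f g : ℝ → ℝ}
    (h : ∫ t in Set.Icc (-(1 / (4 * d : ℝ))) (1 / (4 * d : ℝ)), f t =
      ∫ t in Set.Icc (-(1 / (4 * d : ℝ))) (1 / (4 * d : ℝ)), g t) :
    ∫ t, f t ∂(coordPrior d) = ∫ t, g t ∂(coordPrior d) := by
  rw [coordPrior, ProbabilityTheory.cond, integral_smul_measure, integral_smul_measure, h]

/-- Fubini in the single coordinate `a`: resampling it preserves the prior, which avoids splitting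
the product measure. -/
theorem integral_paramPrior_eq_update (hd : 1 ≤ d) (a : Fin d × Fin d)
    {f : (Fin d × Fin d → ℝ) → ℝ} (hf : Integrable f (paramPrior d)) :
    ∫ θ, f θ ∂(paramPrior d) =
      ∫ θ, ∫ t, f (Function.update θ a t) ∂(coordPrior d) ∂(paramPrior d) := by
  have := isProbabilityMeasure_coordPrior hd
  have := isProbabilityMeasure_paramPrior hd
  have hmp := measurePreserving_update_pi (coordPrior d) a
  have hf' : Integrable f (Measure.pi fun _ => coordPrior d) := hf
  have h2 : Integrable (fun p : (Fin d × Fin d → ℝ) × ℝ => f (Function.update p.1 a p.2))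
      ((paramPrior d).prod (coordPrior d)) := hmp.integrable_comp_of_integrable hf'
  rw [← integral_prod _ h2]
  have h3 := integral_map hmp.measurable.aemeasurable (f := f) (by rw [hmp.map_eq]; exact hf'.1)
  rw [hmp.map_eq] at h3
  exact h3

theorem integral_paramPrior_congr (hd : 1 ≤ d) (a : Fin d × Fin d)
    {f g : (Fin d × Fin d → ℝ) → ℝ} (hf : Integrable f (paramPrior d))
    (hg : Integrable g (paramPrior d))
    (h : ∀ θ ∈ cube d, ∫ t in Set.Icc (-(1 / (4 * d : ℝ))) (1 / (4 * d : ℝ)),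
      f (Function.update θ a t) = ∫ t in Set.Icc (-(1 / (4 * d : ℝ))) (1 / (4 * d : ℝ)),
      g (Function.update θ a t)) :
    ∫ θ, f θ ∂(paramPrior d) = ∫ θ, g θ ∂(paramPrior d) := by
  rw [integral_paramPrior_eq_update hd a hf, integral_paramPrior_eq_update hd a hg]
  refine integral_congr_ae ?_
  filter_upwards [ae_paramPrior_mem_cube hd] with θ hθ
  exact integral_coordPrior_eq (h θ hθ)

/-- With the density written explicitly, the measure on datasets no longer depends on θ, so θ and X
can be exchanged. A bound on E|Φ| uniform over the cube suffices for joint integrability. -/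
theorem integrable_sampleDensity_mul (hd : 1 ≤ d) {n : ℕ}
    {Φ : (Fin d × Fin d → ℝ) × Dataset n d → ℝ} (hΦ : Measurable Φ) {C : ℝ}
    (hi : ∀ θ ∈ cube d, Integrable (fun X => Φ (θ, X)) (gaussianSamples n (covMat θ)))
    (hC : ∀ θ ∈ cube d, ∫ X, |Φ (θ, X)| ∂(gaussianSamples n (covMat θ)) ≤ C) :
    Integrable (fun p : (Fin d × Fin d → ℝ) × Dataset n d =>
      sampleDensity (precMat p.1) p.2 * Φ p) ((paramPrior d).prod volume) := by
  have := isProbabilityMeasure_paramPrior hd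
  have hm : Measurable fun p : (Fin d × Fin d → ℝ) × Dataset n d =>
      sampleDensity (precMat p.1) p.2 :=
    (continuous_sampleDensity.comp ((continuous_precMat.comp continuous_fst).prodMk
      continuous_snd)).measurable
  have hsm := (hm.mul hΦ).aestronglyMeasurable (μ := (paramPrior d).prod volume)
  refine (integrable_prod_iff hsm).2 ⟨?_, ?_⟩
  · filter_upwards [ae_paramPrior_mem_cube hd] with θ hθ
    exact (integrable_gaussianSamples_inv (posDef_precMat hd hθ)).1 (hi θ hθ)
  · refine Integrable.of_bound hsm.norm.integral_prod_right' C ?_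
    filter_upwards [ae_paramPrior_mem_cube hd] with θ hθ
    rw [Real.norm_of_nonneg (integral_nonneg fun _ => norm_nonneg _)]
    refine le_trans (le_of_eq ?_) (hC θ hθ)
    rw [covMat, integral_gaussianSamples_inv (posDef_precMat hd hθ)]
    refine integral_congr_ae (.of_forall fun X => ?_)
    simp [abs_of_nonneg (sampleDensity_nonneg (precMat θ) X)]

end Prior

/-! ### The fingerprinting identity. -/

section Fingerprint

variable {n d : ℕ} {θ : Fin d × Fin d → ℝ}

theorem measurePreserving_eval_gaussianSamples (S : Matrix (Fin d) (Fin d) ℝ) (k : Fin n) :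
    MeasurePreserving (fun X : Dataset n d => X k) (gaussianSamples n S)
      (multivariateGaussian 0 S) :=
  measurePreserving_eval (fun _ : Fin n => multivariateGaussian 0 S) k

theorem integrable_score_eval (S : Matrix (Fin d) (Fin d) ℝ) (θ : Fin d × Fin d → ℝ)
    (a : Fin d × Fin d) (k : Fin n) :
    Integrable (fun X : Dataset n d => score θ a (X k)) (gaussianSamples n S) :=
  (measurePreserving_eval_gaussianSamples S k).integrable_comp_of_integrable (integrable_score S θ a)

theorem integral_score_eval (hd : 1 ≤ d) (hθ : θ ∈ cube d) (a : Fin d × Fin d) (k : Fin n) :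
    ∫ X : Dataset n d, score θ a (X k) ∂(gaussianSamples n (covMat θ)) = 0 := by
  have hmp := measurePreserving_eval_gaussianSamples (n := n) (covMat θ) k
  have h3 := integral_map hmp.measurable.aemeasurable (f := score θ a)
    (by rw [hmp.map_eq]; exact (integrable_score _ θ a).1)
  rw [hmp.map_eq, integral_score hd hθ] at h3
  exact h3.symm

theorem integrable_bounded_mul_score {h : Dataset n d → ℝ} (hm : Measurable h) {K : ℝ}
    (hK : ∀ X, |h X| ≤ K) (S : Matrix (Fin d) (Fin d) ℝ) (θ : Fin d × Fin d → ℝ)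
    (a : Fin d × Fin d) (k : Fin n) :
    Integrable (fun X : Dataset n d => h X * score θ a (X k)) (gaussianSamples n S) :=
  (integrable_score_eval S θ a k).bdd_mul hm.aestronglyMeasurable (.of_forall hK)

theorem integral_abs_bounded_mul_sum_score_le (hd : 1 ≤ d) (hθ : θ ∈ cube d)
    {h : Dataset n d → ℝ} {K : ℝ} (hK : ∀ X, |h X| ≤ K) (hK0 : 0 ≤ K)
    (a : Fin d × Fin d) :
    ∫ X, |h X * ∑ k, score θ a (X k)| ∂(gaussianSamples n (covMat θ)) ≤ K * (n * (3 * d)) := by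
  have hmp := fun k : Fin n => measurePreserving_eval_gaussianSamples (covMat θ) k
  have hi1 := (integrable_sum_sq (covMat θ)).integrable one_le_two
  have hi : ∀ k : Fin n, Integrable (fun X : Dataset n d => (d : ℝ) + ∑ i, X k i ^ 2)
      (gaussianSamples n (covMat θ)) := fun k =>
    (integrable_const _).add ((hmp k).integrable_comp_of_integrable hi1)
  have hv : ∀ k : Fin n, ∫ X : Dataset n d, ((d : ℝ) + ∑ i, X k i ^ 2)
      ∂(gaussianSamples n (covMat θ)) ≤ 3 * d := fun k => by
    have h3 := integral_map (hmp k).measurable.aemeasurable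
      (f := fun x : EuclideanSpace ℝ (Fin d) => ∑ i, x i ^ 2)
      (by rw [(hmp k).map_eq]; exact hi1.1)
    rw [(hmp k).map_eq] at h3
    have h4 : Integrable (fun X : Dataset n d => ∑ i, X k i ^ 2) (gaussianSamples n (covMat θ)) :=
      (hmp k).integrable_comp_of_integrable hi1
    rw [integral_add (integrable_const _) h4, ← h3]
    have := integral_sum_sq_le hd hθ
    simp only [integral_const, probReal_univ, one_smul]
    linarith
  calc ∫ X, |h X * ∑ k, score θ a (X k)| ∂(gaussianSamples n (covMat θ))
      ≤ ∫ X : Dataset n d, K * ∑ k, ((d : ℝ) + ∑ i, X k i ^ 2) ∂(gaussianSamples n (covMat θ)) := by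
        refine integral_mono_of_nonneg (.of_forall fun _ => abs_nonneg _)
          ((integrable_finsetSum _ fun k _ => hi k).const_mul K) (.of_forall fun X => ?_)
        simp only [abs_mul]
        exact mul_le_mul (hK X) ((Finset.abs_sum_le_sum_abs _ _).trans
          (Finset.sum_le_sum fun k _ => abs_score_le hd hθ a (X k))) (abs_nonneg _) hK0
    _ ≤ K * (n * (3 * d)) := by
        rw [integral_const_mul, integral_finsetSum _ fun k _ => hi k]
        refine mul_le_mul_of_nonneg_left ?_ hK0
        refine (Finset.sum_le_sum fun k _ => hv k).trans (by simp)

theorem abs_parabola_le_one (hd : 1 ≤ d) (hθ : θ ∈ cube d) (a : Fin d × Fin d) :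
    |(1 / (4 * d : ℝ)) ^ 2 - θ a ^ 2| ≤ 1 ∧ |2 * θ a| ≤ 2 := by
  have hd' : (1 : ℝ) ≤ d := by exact_mod_cast hd
  have h1 := hθ a
  have hr0 : 0 < 1 / (4 * d : ℝ) := by positivity
  have hr1 : 1 / (4 * d : ℝ) ≤ 1 := by rw [div_le_one (by positivity)]; linarith
  set r : ℝ := 1 / (4 * d : ℝ)
  have h2 : θ a ^ 2 ≤ r ^ 2 := sq_le_sq' h1.1 h1.2
  have h3 : r ^ 2 ≤ 1 := by nlinarith
  rw [abs_le, abs_le]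
  refine ⟨⟨?_, ?_⟩, ?_, ?_⟩ <;> nlinarith [sq_nonneg (θ a), h1.1, h1.2]

theorem measurable_score_eval (a : Fin d × Fin d) (k : Fin n) :
    Measurable fun p : (Fin d × Fin d → ℝ) × Dataset n d => score p.1 a (p.2 k) := by
  unfold score
  have h : Measurable fun p : (Fin d × Fin d → ℝ) × Dataset n d => covMat p.1 a.1 a.2 :=
    (measurable_covMat_apply a.1 a.2).comp measurable_fst
  refine (h.sub ?_).div_const 2
  fun_prop

theorem integrable_density_mul_score (hd : 1 ≤ d) {h : Dataset n d → ℝ} (hm : Measurable h) {K : ℝ}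
    (hK : ∀ X, |h X| ≤ K) (a : Fin d × Fin d) :
    Integrable (fun p : (Fin d × Fin d → ℝ) × Dataset n d => sampleDensity (precMat p.1) p.2 *
      (((1 / (4 * d : ℝ)) ^ 2 - p.1 a ^ 2) * (h p.2 * ∑ k, score p.1 a (p.2 k))))
      ((paramPrior d).prod volume) := by
  have hK0 : 0 ≤ K := (abs_nonneg _).trans (hK fun _ => 0)
  have hsm := measurable_score_eval (n := n) a
  have hθm : Measurable fun p : (Fin d × Fin d → ℝ) × Dataset n d => p.1 a :=
    (measurable_pi_apply a).comp measurable_fst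
  have hΦ : Measurable fun p : (Fin d × Fin d → ℝ) × Dataset n d =>
      ((1 / (4 * d : ℝ)) ^ 2 - p.1 a ^ 2) * (h p.2 * ∑ k, score p.1 a (p.2 k)) :=
    (measurable_const.sub (hθm.pow_const 2)).mul ((hm.comp measurable_snd).mul
        (Finset.measurable_sum _ fun k _ => hsm k))
  refine integrable_sampleDensity_mul hd (C := K * (n * (3 * d))) hΦ (fun θ hθ => ?_) fun θ hθ => ?_
  · refine Integrable.const_mul ?_ ((1 / (4 * d : ℝ)) ^ 2 - θ a ^ 2)
    simp only [Finset.mul_sum]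
    exact integrable_finsetSum _ fun k _ => integrable_bounded_mul_score hm hK _ _ _ _
  · have e : ∀ X : Dataset n d, |((1 / (4 * d : ℝ)) ^ 2 - θ a ^ 2) *
        (h X * ∑ k, score θ a (X k))| = |(1 / (4 * d : ℝ)) ^ 2 - θ a ^ 2| *
        |h X * ∑ k, score θ a (X k)| := fun X => abs_mul _ _
    simp only [e]
    rw [integral_const_mul]
    have h1 := integral_abs_bounded_mul_sum_score_le hd hθ hK hK0 a
    have h2 : 0 ≤ ∫ X, |h X * ∑ k, score θ a (X k)| ∂(gaussianSamples n (covMat θ)) :=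
      integral_nonneg fun _ => abs_nonneg _
    exact (mul_le_of_le_one_left h2 (abs_parabola_le_one hd hθ a).1).trans h1

theorem integrable_density_mul_param (hd : 1 ≤ d) {h : Dataset n d → ℝ} (hm : Measurable h) {K : ℝ}
    (hK : ∀ X, |h X| ≤ K) (a : Fin d × Fin d) :
    Integrable (fun p : (Fin d × Fin d → ℝ) × Dataset n d => sampleDensity (precMat p.1) p.2 *
      (2 * p.1 a * h p.2)) ((paramPrior d).prod volume) := by
  have hhi : ∀ S, Integrable h (gaussianSamples n S) := fun S =>
    Integrable.of_bound hm.aestronglyMeasurable K (.of_forall hK)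
  have hθm : Measurable fun p : (Fin d × Fin d → ℝ) × Dataset n d => p.1 a :=
    (measurable_pi_apply a).comp measurable_fst
  have hΦ : Measurable fun p : (Fin d × Fin d → ℝ) × Dataset n d => 2 * p.1 a * h p.2 :=
    (hθm.const_mul 2).mul (hm.comp measurable_snd)
  refine integrable_sampleDensity_mul hd (C := 2 * K) hΦ (fun θ hθ => (hhi _).const_mul (2 * θ a))
    fun θ hθ => ?_
  have e : ∀ X : Dataset n d, |2 * θ a * h X| = |2 * θ a| * |h X| := fun X => abs_mul _ _
  simp only [e]
  rw [integral_const_mul]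
  have h1 : ∫ X, |h X| ∂(gaussianSamples n (covMat θ)) ≤ K := by
    refine (integral_mono (hhi _).abs (integrable_const K) hK).trans (by simp)
  have h2 : 0 ≤ ∫ X, |h X| ∂(gaussianSamples n (covMat θ)) :=
    integral_nonneg fun _ => abs_nonneg _
  exact mul_le_mul (abs_parabola_le_one hd hθ a).2 h1 h2 (by norm_num)

theorem integral_parabola_mul_score_density (hd : 1 ≤ d) (hθ : θ ∈ cube d) (a : Fin d × Fin d)
    (X : Dataset n d) :
    ∫ t in Set.Icc (-(1 / (4 * d : ℝ))) (1 / (4 * d : ℝ)), ((1 / (4 * d : ℝ)) ^ 2 - t ^ 2) *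
      ((∑ k, score (Function.update θ a t) a (X k)) *
        sampleDensity (precMat (Function.update θ a t)) X) =
    ∫ t in Set.Icc (-(1 / (4 * d : ℝ))) (1 / (4 * d : ℝ)),
      2 * t * sampleDensity (precMat (Function.update θ a t)) X := by
  have hd' : (1 : ℝ) ≤ d := by exact_mod_cast hd
  have hpd : ∀ t ∈ Set.Icc (-(1 / (4 * d : ℝ))) (1 / (4 * d : ℝ)),
      (precMat (Function.update θ a t)).PosDef := fun t ht =>
    posDef_precMat hd (update_mem_cube hθ a ht)
  have hupd : Continuous fun t : ℝ => Function.update θ a t := continuous_const.update a continuous_id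
  refine integral_parabola_mul_deriv (by positivity)
    (fun t ht => hasDerivAt_prod_precisionDensity a (hpd t ht) X) ?_
  refine ContinuousOn.mul (continuousOn_finsetSum _ fun k _ => ?_) (Continuous.continuousOn ?_)
  · unfold score
    refine ContinuousOn.div_const (ContinuousOn.sub ?_ continuousOn_const) 2
    exact (continuousOn_covMat_apply a.1 a.2).comp hupd.continuousOn
      fun t ht => (hpd t ht).det_pos.ne'
  · exact continuous_sampleDensity.comp ((continuous_precMat.comp hupd).prodMk continuous_const)

/-- Exchange the integrals over θ and X. For fixed X, `h X` is a constant, and in the coordinate θ_a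
the total score times the density is the derivative of the density; integration by parts against the
parabola moves the derivative to the weight. -/
theorem fingerprint_identity (hd : 1 ≤ d) {h : Dataset n d → ℝ} (hm : Measurable h) {K : ℝ}
    (hK : ∀ X, |h X| ≤ K) (a : Fin d × Fin d) :
    Integrable (fun θ => ((1 / (4 * d : ℝ)) ^ 2 - θ a ^ 2) *
      ∫ X, h X * ∑ k, score θ a (X k) ∂(gaussianSamples n (covMat θ))) (paramPrior d) ∧
    Integrable (fun θ => 2 * θ a * ∫ X, h X ∂(gaussianSamples n (covMat θ))) (paramPrior d) ∧
    ∫ θ, ((1 / (4 * d : ℝ)) ^ 2 - θ a ^ 2) *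
      ∫ X, h X * ∑ k, score θ a (X k) ∂(gaussianSamples n (covMat θ)) ∂(paramPrior d) =
    ∫ θ, 2 * θ a * ∫ X, h X ∂(gaussianSamples n (covMat θ)) ∂(paramPrior d) := by
  have := isProbabilityMeasure_paramPrior hd
  have hFi := integrable_density_mul_score hd hm hK a
  have hGi := integrable_density_mul_param hd hm hK a
  have hFe : (fun θ => ∫ X, sampleDensity (precMat θ) X * (((1 / (4 * d : ℝ)) ^ 2 - θ a ^ 2) *
      (h X * ∑ k, score θ a (X k)))) =ᵐ[paramPrior d] fun θ => ((1 / (4 * d : ℝ)) ^ 2 - θ a ^ 2) *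
      ∫ X, h X * ∑ k, score θ a (X k) ∂(gaussianSamples n (covMat θ)) := by
    filter_upwards [ae_paramPrior_mem_cube hd] with θ hθ
    rw [covMat, ← integral_const_mul, integral_gaussianSamples_inv (posDef_precMat hd hθ)]
  have hGe : (fun θ => ∫ X, sampleDensity (precMat θ) X * (2 * θ a * h X)) =ᵐ[paramPrior d]
      fun θ => 2 * θ a * ∫ X, h X ∂(gaussianSamples n (covMat θ)) := by
    filter_upwards [ae_paramPrior_mem_cube hd] with θ hθ
    rw [covMat, ← integral_const_mul, integral_gaussianSamples_inv (posDef_precMat hd hθ)]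
  refine ⟨hFi.integral_prod_left.congr hFe, hGi.integral_prod_left.congr hGe, ?_⟩
  rw [← integral_congr_ae hFe, ← integral_congr_ae hGe,
    integral_integral_swap (f := fun θ X => sampleDensity (precMat θ) X *
      (((1 / (4 * d : ℝ)) ^ 2 - θ a ^ 2) * (h X * ∑ k, score θ a (X k)))) hFi,
    integral_integral_swap (f := fun θ X => sampleDensity (precMat θ) X * (2 * θ a * h X)) hGi]
  refine integral_congr_ae ?_
  filter_upwards [hFi.prod_left_ae, hGi.prod_left_ae] with X hFX hGX
  refine integral_paramPrior_congr hd a hFX hGX fun θ hθ => ?_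
  have e1 : ∀ t, sampleDensity (precMat (Function.update θ a t)) X *
      (((1 / (4 * d : ℝ)) ^ 2 - Function.update θ a t a ^ 2) *
      (h X * ∑ k, score (Function.update θ a t) a (X k))) =
      h X * (((1 / (4 * d : ℝ)) ^ 2 - t ^ 2) * ((∑ k, score (Function.update θ a t) a (X k)) *
        sampleDensity (precMat (Function.update θ a t)) X)) := fun t => by
    rw [Function.update_self]; ring
  have e2 : ∀ t, sampleDensity (precMat (Function.update θ a t)) X *
      (2 * Function.update θ a t a * h X) = h X * (2 * t *
      sampleDensity (precMat (Function.update θ a t)) X) := fun t => by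
    rw [Function.update_self]; ring
  simp only [e1, e2]
  rw [integral_const_mul, integral_const_mul, integral_parabola_mul_score_density hd hθ]

end Fingerprint

/-! ### Truncation of the output. -/

/-- Replace `B` by `(4/3) I` if it is far from `(4/3) I`. -/
noncomputable def resetMat {d : ℕ} (B : Matrix (Fin d) (Fin d) ℝ) : Matrix (Fin d) (Fin d) ℝ :=
  open Classical in if frobSq (B - (4 / 3 : ℝ) • 1) ≤ 16 / 9 then B else (4 / 3 : ℝ) • 1

section Reset

variable {d : ℕ} {θ : Fin d × Fin d → ℝ}

theorem measurable_matrix_apply (i j : Fin d) :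
    Measurable fun B : Matrix (Fin d) (Fin d) ℝ => B i j :=
  (measurable_pi_apply j).comp (measurable_pi_apply (X := fun _ : Fin d => Fin d → ℝ) i)

theorem measurable_frobSq_sub {α : Type*} [MeasurableSpace α] {A B : α → Matrix (Fin d) (Fin d) ℝ}
    (hA : ∀ i j, Measurable fun a => A a i j) (hB : ∀ i j, Measurable fun a => B a i j) :
    Measurable fun a => frobSq (A a - B a) :=
  Finset.measurable_sum _ fun i _ => Finset.measurable_sum _ fun j _ =>
    ((hA i j).sub (hB i j)).pow_const 2

theorem measurable_resetMat_apply (i j : Fin d) :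
    Measurable fun B : Matrix (Fin d) (Fin d) ℝ => resetMat B i j := by
  have hs : MeasurableSet {B : Matrix (Fin d) (Fin d) ℝ | frobSq (B - (4 / 3 : ℝ) • 1) ≤ 16 / 9} :=
    measurableSet_le (measurable_frobSq_sub measurable_matrix_apply fun _ _ => measurable_const)
      measurable_const
  classical
  have h : (fun B : Matrix (Fin d) (Fin d) ℝ => resetMat B i j) = fun B =>
      if frobSq (B - (4 / 3 : ℝ) • 1) ≤ 16 / 9 then B i j
      else ((4 / 3 : ℝ) • (1 : Matrix (Fin d) (Fin d) ℝ)) i j := by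
    ext B
    unfold resetMat
    split_ifs <;> rfl
  rw [h]
  exact Measurable.ite hs (measurable_matrix_apply i j) measurable_const

theorem frobSq_resetMat_sub_center_le (B : Matrix (Fin d) (Fin d) ℝ) :
    frobSq (resetMat B - (4 / 3 : ℝ) • 1) ≤ 16 / 9 := by
  unfold resetMat
  split_ifs with h
  · exact h
  · simp [frobSq]; norm_num

theorem frobSq_sub_comm (A B : Matrix (Fin d) (Fin d) ℝ) : frobSq (A - B) = frobSq (B - A) := by
  simp only [frobSq, Matrix.sub_apply]
  exact Finset.sum_congr rfl fun i _ => Finset.sum_congr rfl fun j _ => by ring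

/-- The cutoff radius 4/3 is twice the radius 2/3 of the ball about (4/3)I that contains every Σ. A
matrix that gets reset is therefore no closer to Σ than the centre is. -/
theorem frobSq_resetMat_sub_le (hd : 1 ≤ d) (hθ : θ ∈ cube d) (B : Matrix (Fin d) (Fin d) ℝ) :
    frobSq (resetMat B - covMat θ) ≤ frobSq (B - covMat θ) := by
  unfold resetMat
  split_ifs with h
  · exact le_rfl
  · have h1 := frobSq_covMat_sub_le hd hθ
    have h2 := frobSq_add_le (B - covMat θ) (covMat θ - (4 / 3 : ℝ) • 1)
    rw [sub_add_sub_cancel] at h2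
    rw [frobSq_sub_comm]
    linarith

theorem frobSq_resetMat_sub_le_five (hd : 1 ≤ d) (hθ : θ ∈ cube d)
    (B : Matrix (Fin d) (Fin d) ℝ) : frobSq (resetMat B - covMat θ) ≤ 5 := by
  have h1 := frobSq_covMat_sub_le hd hθ
  have h2 := frobSq_add_le (resetMat B - (4 / 3 : ℝ) • 1) ((4 / 3 : ℝ) • 1 - covMat θ)
  rw [sub_add_sub_cancel, frobSq_sub_comm (_ • _) (covMat θ)] at h2
  linarith [frobSq_resetMat_sub_center_le B]

theorem abs_resetMat_apply_le (B : Matrix (Fin d) (Fin d) ℝ) (i j : Fin d) :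
    |resetMat B i j| ≤ 3 := by
  have h1 := (sq_apply_le_frobSq (resetMat B - (4 / 3 : ℝ) • 1) i j).trans
    (frobSq_resetMat_sub_center_le B)
  have h2 : |(resetMat B - (4 / 3 : ℝ) • 1) i j| ≤ 4 / 3 :=
    abs_le_of_sq_le_sq (by linarith) (by norm_num)
  have h3 : |((4 / 3 : ℝ) • (1 : Matrix (Fin d) (Fin d) ℝ)) i j| ≤ 4 / 3 := by
    rw [Matrix.smul_apply, Matrix.one_apply]; split_ifs <;> norm_num
  rw [Matrix.sub_apply] at h2
  rw [abs_le] at *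
  constructor <;> linarith [h2.1, h2.2, h3.1, h3.2]

end Reset

/-! ### The correlation of the error with the score of one point. -/

section Attack

variable {d : ℕ} {θ : Fin d × Fin d → ℝ}

/-- The error of the truncated estimate, weighted by the parabola that vanishes on the boundary
of the cube of parameters. -/
noncomputable def weightedErr (θ : Fin d × Fin d → ℝ) (B : Matrix (Fin d) (Fin d) ℝ) :
    Matrix (Fin d) (Fin d) ℝ :=
  Matrix.of fun i j =>
    ((1 / (4 * d : ℝ)) ^ 2 - θ (i, j) ^ 2) * (resetMat B i j - covMat θ i j)

/-- The correlation of the weighted error with the score of the sample point `x`. -/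
noncomputable def attack (θ : Fin d × Fin d → ℝ) (x : EuclideanSpace ℝ (Fin d))
    (B : Matrix (Fin d) (Fin d) ℝ) : ℝ :=
  ∑ a, weightedErr θ B a.1 a.2 * score θ a x

/-- An upper bound for the absolute value of the correlation. -/
noncomputable def attackBound (x : EuclideanSpace ℝ (Fin d)) : ℝ :=
  3 * (1 / (4 * d : ℝ)) ^ 2 * (d + ∑ i, x i ^ 2)

theorem frobSq_weightedErr_le (hθ : θ ∈ cube d) (B : Matrix (Fin d) (Fin d) ℝ) :
    frobSq (weightedErr θ B) ≤ ((1 / (4 * d : ℝ)) ^ 2) ^ 2 * frobSq (resetMat B - covMat θ) := by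
  simp only [frobSq, Finset.mul_sum]
  refine Finset.sum_le_sum fun i _ => Finset.sum_le_sum fun j _ => ?_
  have h1 := hθ (i, j)
  have h2 : θ (i, j) ^ 2 ≤ (1 / (4 * d : ℝ)) ^ 2 := sq_le_sq' h1.1 h1.2
  rw [weightedErr, Matrix.of_apply, mul_pow, Matrix.sub_apply]
  exact mul_le_mul_of_nonneg_right
    (pow_le_pow_left₀ (by linarith) (by linarith [sq_nonneg (θ (i, j))]) 2) (sq_nonneg _)

theorem attack_eq (θ : Fin d × Fin d → ℝ) (x : EuclideanSpace ℝ (Fin d))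
    (B : Matrix (Fin d) (Fin d) ℝ) :
    attack θ x B = (∑ i, ∑ j, weightedErr θ B i j * covMat θ i j -
      quadForm (weightedErr θ B) x) / 2 := sum_mul_score _ _

/-- Uniformity in `B` is the purpose of the truncation: it supplies the bound K by which δ is
multiplied. -/
theorem abs_attack_le (hd : 1 ≤ d) (hθ : θ ∈ cube d) (x : EuclideanSpace ℝ (Fin d))
    (B : Matrix (Fin d) (Fin d) ℝ) : |attack θ x B| ≤ attackBound x := by
  have hc : 0 ≤ 3 * (1 / (4 * d : ℝ)) ^ 2 := by positivity
  have hU : frobSq (weightedErr θ B) ≤ (3 * (1 / (4 * d : ℝ)) ^ 2) ^ 2 := by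
    refine (frobSq_weightedErr_le hθ B).trans ?_
    have := mul_le_mul_of_nonneg_left (frobSq_resetMat_sub_le_five hd hθ B)
      (sq_nonneg ((1 / (4 * d : ℝ)) ^ 2))
    nlinarith [sq_nonneg ((1 / (4 * d : ℝ)) ^ 2)]
  have h1 := abs_quadForm_le hc hU x
  have h2 : |∑ i, ∑ j, weightedErr θ B i j * covMat θ i j| ≤
      3 * (1 / (4 * d : ℝ)) ^ 2 * (2 * d) := by
    refine abs_le_of_sq_le_sq ?_ (by positivity)
    rw [mul_pow]
    exact (sum_sum_mul_sq_le _ _).trans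
      (mul_le_mul hU (frobSq_covMat_le hd hθ) (frobSq_nonneg _) (sq_nonneg _))
  have h0 : 0 ≤ 3 * (1 / (4 * d : ℝ)) ^ 2 * ∑ i, x i ^ 2 :=
    mul_nonneg hc (Finset.sum_nonneg fun _ _ => sq_nonneg _)
  rw [attack_eq, attackBound, mul_add]
  rw [abs_le] at *
  constructor <;> linarith [h1.1, h1.2, h2.1, h2.2]

theorem memLp_attackBound (S : Matrix (Fin d) (Fin d) ℝ) :
    MemLp (attackBound (d := d)) 2 (multivariateGaussian 0 S) :=
  ((memLp_const (d : ℝ)).add (integrable_sum_sq S)).const_mul _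

theorem integral_attackBound_le (hd : 1 ≤ d) (hθ : θ ∈ cube d) :
    ∫ x, attackBound x ∂(multivariateGaussian 0 (covMat θ)) ≤ 9 * (1 / (4 * d : ℝ)) ^ 2 * d := by
  unfold attackBound
  rw [integral_const_mul, integral_add (integrable_const _)
    ((integrable_sum_sq (covMat θ)).integrable one_le_two)]
  have h := integral_sum_sq_le hd hθ
  simp only [integral_const, probReal_univ, one_smul]
  have := mul_le_mul_of_nonneg_left h (by positivity : 0 ≤ 3 * (1 / (4 * d : ℝ)) ^ 2)
  linarith

theorem measurable_weightedErr_apply (θ : Fin d × Fin d → ℝ) (i j : Fin d) :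
    Measurable fun B : Matrix (Fin d) (Fin d) ℝ => weightedErr θ B i j :=
  ((measurable_resetMat_apply i j).sub_const _).const_mul _

theorem measurable_score_right (θ : Fin d × Fin d → ℝ) (a : Fin d × Fin d) :
    Measurable (score θ a) := by
  unfold score; fun_prop

theorem measurable_attack (θ : Fin d × Fin d → ℝ) :
    Measurable fun p : EuclideanSpace ℝ (Fin d) × Matrix (Fin d) (Fin d) ℝ => attack θ p.1 p.2 :=
  Finset.measurable_sum _ fun a _ => ((measurable_weightedErr_apply θ a.1 a.2).comp
    measurable_snd).mul ((measurable_score_right θ a).comp measurable_fst)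

theorem measurable_attack_right (θ : Fin d × Fin d → ℝ) (x : EuclideanSpace ℝ (Fin d)) :
    Measurable (attack θ x) :=
  Finset.measurable_sum _ fun a _ => (measurable_weightedErr_apply θ a.1 a.2).mul_const _

theorem gaussianSqVariance_nonneg : 0 ≤ gaussianSqVariance := variance_nonneg _ _

/-- For fixed `B` the sum over all d² score entries is one centred quadratic form, so its second
moment sees only the Frobenius norm of the weighted error. -/
theorem integral_attack_sq_le (hd : 1 ≤ d) (hθ : θ ∈ cube d) (B : Matrix (Fin d) (Fin d) ℝ) :
    ∫ x, attack θ x B ^ 2 ∂(multivariateGaussian 0 (covMat θ)) ≤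
      gaussianSqVariance * ((1 / (4 * d : ℝ)) ^ 2) ^ 2 * frobSq (resetMat B - covMat θ) := by
  have e : ∀ x, attack θ x B ^ 2 = 1 / 4 * (quadForm (weightedErr θ B) x -
      ∑ i, ∑ j, weightedErr θ B i j * covMat θ i j) ^ 2 := fun x => by rw [attack_eq]; ring
  simp only [e]
  rw [integral_const_mul]
  have h := integral_quadForm_sub_sq_le (covMat_nonneg hd hθ) (covMat_le_two hd hθ)
    (weightedErr θ B)
  have h2 := mul_le_mul_of_nonneg_left (frobSq_weightedErr_le hθ B)
    gaussianSqVariance_nonneg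
  linarith

theorem abs_weightedErr_apply_le (hd : 1 ≤ d) (hθ : θ ∈ cube d) (B : Matrix (Fin d) (Fin d) ℝ)
    (i j : Fin d) : |weightedErr θ B i j| ≤ 3 := by
  have h1 := (sq_apply_le_frobSq (resetMat B - covMat θ) i j).trans
    (frobSq_resetMat_sub_le_five hd hθ B)
  have h2 : |(resetMat B - covMat θ) i j| ≤ 3 := abs_le_of_sq_le_sq (by linarith) (by norm_num)
  rw [weightedErr, Matrix.of_apply, abs_mul]
  have h3 := (abs_parabola_le_one hd hθ (i, j)).1
  rw [Matrix.sub_apply] at h2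
  nlinarith [abs_nonneg ((1 / (4 * d : ℝ)) ^ 2 - θ (i, j) ^ 2)]

end Attack

/-! ### Privacy bounds the correlation of each sample point. -/

section DPBound

variable {n d : ℕ} {θ : Fin d × Fin d → ℝ} {ε δ : ℝ}

theorem IsDP.update_le {𝒳 𝒴 : Type*} [MeasurableSpace 𝒳] [MeasurableSpace 𝒴]
    {M : Kernel (Fin n → 𝒳) 𝒴} (hM : IsDP ε δ M) (hε : 0 ≤ ε) (X : Fin n → 𝒳) (k : Fin n) (x : 𝒳)
    {Y : Set 𝒴} (hY : MeasurableSet Y) :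
    M (Function.update X k x) Y ≤ ENNReal.ofReal (Real.exp ε) * M X Y + ENNReal.ofReal δ ∧
    M X Y ≤ ENNReal.ofReal (Real.exp ε) * M (Function.update X k x) Y + ENNReal.ofReal δ := by
  -- Putting back the same point gives equal datasets, which are not neighbouring; then e^ε ≥ 1
  -- suffices.
  by_cases h : x = X k
  · have h1 : (1 : ℝ≥0∞) ≤ ENNReal.ofReal (Real.exp ε) := by
      rw [ENNReal.one_le_ofReal]; exact Real.one_le_exp hε
    have h2 : M X Y ≤ ENNReal.ofReal (Real.exp ε) * M X Y + ENNReal.ofReal δ :=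
      (le_mul_of_one_le_left' h1).trans le_self_add
    rw [h, Function.update_eq_self]
    exact ⟨h2, h2⟩
  · have hn : Neighboring (Function.update X k x) X := by
      refine ⟨k, by simpa using h, fun i hi => ?_⟩
      by_contra hik
      exact hi (Function.update_of_ne hik _ _)
    have hn' : Neighboring X (Function.update X k x) := by
      obtain ⟨i, hi, hu⟩ := hn
      exact ⟨i, hi.symm, fun j hj => hu j (Ne.symm hj)⟩
    exact ⟨hM _ _ hn Y hY, hM _ _ hn' Y hY⟩

theorem measurable_integral_kernel {M : Kernel (Dataset n d) (Matrix (Fin d) (Fin d) ℝ)}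
    {g : Matrix (Fin d) (Fin d) ℝ → ℝ} (hg : Measurable g) :
    Measurable fun X => ∫ B, g B ∂(M X) :=
  (hg.stronglyMeasurable.integral_kernel (κ := M)).measurable

variable {M : Kernel (Dataset n d) (Matrix (Fin d) (Fin d) ℝ)}

/-- The posterior mean of the weighted error, given the data. -/
noncomputable def meanWeightedErr (M : Kernel (Dataset n d) (Matrix (Fin d) (Fin d) ℝ))
    (θ : Fin d × Fin d → ℝ) (a : Fin d × Fin d) (X : Dataset n d) : ℝ :=
  ∫ B, weightedErr θ B a.1 a.2 ∂(M X)

theorem measurable_meanWeightedErr (a : Fin d × Fin d) : Measurable (meanWeightedErr M θ a) :=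
  measurable_integral_kernel (measurable_weightedErr_apply θ a.1 a.2)

variable [IsMarkovKernel M]

theorem integrable_of_abs_le {ρ : Measure (Matrix (Fin d) (Fin d) ℝ)} [IsProbabilityMeasure ρ]
    {g : Matrix (Fin d) (Fin d) ℝ → ℝ} (hg : Measurable g) {K : ℝ} (hK : ∀ B, |g B| ≤ K) :
    Integrable g ρ := Integrable.of_bound hg.aestronglyMeasurable K (.of_forall hK)

theorem abs_integral_le {ρ : Measure (Matrix (Fin d) (Fin d) ℝ)} [IsProbabilityMeasure ρ]
    {g : Matrix (Fin d) (Fin d) ℝ → ℝ} {K : ℝ} (hK : ∀ B, |g B| ≤ K) :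
    |(∫ B, g B ∂ρ)| ≤ K := by
  simpa using norm_integral_le_of_norm_le_const (μ := ρ) (f := g) (C := K) (.of_forall hK)

theorem abs_meanWeightedErr_le (hd : 1 ≤ d) (hθ : θ ∈ cube d) (a : Fin d × Fin d)
    (X : Dataset n d) : |meanWeightedErr M θ a X| ≤ 3 :=
  abs_integral_le fun B => abs_weightedErr_apply_le hd hθ B a.1 a.2

theorem integral_attack_eq (hd : 1 ≤ d) (hθ : θ ∈ cube d) (x : EuclideanSpace ℝ (Fin d))
    (X : Dataset n d) :
    ∫ B, attack θ x B ∂(M X) = ∑ a, meanWeightedErr M θ a X * score θ a x := by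
  unfold attack
  rw [integral_finsetSum]
  · simp only [integral_mul_const, meanWeightedErr]
  · intro a _
    exact (integrable_of_abs_le (measurable_weightedErr_apply θ a.1 a.2)
      fun B => abs_weightedErr_apply_le hd hθ B a.1 a.2).mul_const _

/-- Compare M on X with and without `x` in place k. The term 2ε E|A| is bounded by ε(l + E A²/l),
where A is the correlation; the free parameter `l` replaces the square root of Cauchy–Schwarz and is
optimized at the very end. -/
theorem integral_attack_update_le (hd : 1 ≤ d) (hθ : θ ∈ cube d) (hM : IsDP ε δ M) (hε : 0 ≤ ε)
    (hε1 : ε ≤ 1) (hδ : 0 ≤ δ) {l : ℝ} (hl : 0 < l) (X : Dataset n d) (k : Fin n)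
    (x : EuclideanSpace ℝ (Fin d)) :
    -∫ B, attack θ x B ∂(M (Function.update X k x)) ≤ -(∫ B, attack θ x B ∂(M X)) +
      ε * (l + (∫ B, attack θ x B ^ 2 ∂(M X)) / l) + 2 * δ * attackBound x := by
  have h := integral_le_integral_add_of_measure_le (P := M (Function.update X k x)) (Q := M X)
    hε hε1 hδ (fun Y hY => (hM.update_le hε X k x hY).1) (fun Y hY => (hM.update_le hε X k x hY).2)
    (measurable_attack_right θ x).neg (K := attackBound x)
    (fun B => by rw [Pi.neg_apply, abs_neg]; exact abs_attack_le hd hθ x B)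
  simp only [Pi.neg_apply, abs_neg, integral_neg] at h
  have hi : Integrable (fun B => |attack θ x B|) (M X) :=
    (integrable_of_abs_le (measurable_attack_right θ x) (abs_attack_le hd hθ x)).abs
  have hi2 : Integrable (fun B => attack θ x B ^ 2) (M X) :=
    integrable_of_abs_le (K := attackBound x ^ 2) ((measurable_attack_right θ x).pow_const 2)
      fun B => by
        rw [abs_of_nonneg (sq_nonneg _), ← sq_abs]
        exact pow_le_pow_left₀ (abs_nonneg _) (abs_attack_le hd hθ x B) 2
  have h2 : ∫ B, |attack θ x B| ∂(M X) ≤ ∫ B, (l / 2 + attack θ x B ^ 2 / (2 * l)) ∂(M X) := by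
    refine integral_mono hi ((integrable_const _).add (hi2.div_const _)) fun B => ?_
    have e : l / 2 + attack θ x B ^ 2 / (2 * l) - |attack θ x B| =
        (l - |attack θ x B|) ^ 2 / (2 * l) := by
      rw [← sq_abs (attack θ x B)]; field_simp; ring
    have : 0 ≤ (l - |attack θ x B|) ^ 2 / (2 * l) := by positivity
    simp only; linarith
  rw [integral_add (integrable_const _) (hi2.div_const _), integral_const,
    probReal_univ, one_smul, integral_div (2 * l) (fun B => attack θ x B ^ 2)] at h2
  have h3 := mul_le_mul_of_nonneg_left h2 (by positivity : 0 ≤ 2 * ε)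
  have e2 : 2 * ε * (l / 2 + (∫ B, attack θ x B ^ 2 ∂(M X)) / (2 * l)) =
      ε * (l + (∫ B, attack θ x B ^ 2 ∂(M X)) / l) := by field_simp
  rw [e2] at h3
  linarith

/-- The mean squared Frobenius error of the truncated estimate. -/
noncomputable def meanSqErr (M : Kernel (Dataset n d) (Matrix (Fin d) (Fin d) ℝ))
    (θ : Fin d × Fin d → ℝ) : ℝ :=
  ∫ X, ∫ B, frobSq (resetMat B - covMat θ) ∂(M X) ∂(gaussianSamples n (covMat θ))

theorem measurable_frobSq_resetMat_sub (S : Matrix (Fin d) (Fin d) ℝ) :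
    Measurable fun B : Matrix (Fin d) (Fin d) ℝ => frobSq (resetMat B - S) :=
  measurable_frobSq_sub measurable_resetMat_apply fun _ _ => measurable_const

theorem abs_frobSq_resetMat_sub_le (hd : 1 ≤ d) (hθ : θ ∈ cube d) (B : Matrix (Fin d) (Fin d) ℝ) :
    |frobSq (resetMat B - covMat θ)| ≤ 5 := by
  rw [abs_of_nonneg (frobSq_nonneg _)]
  exact frobSq_resetMat_sub_le_five hd hθ B

theorem integrable_integral_frobSq (hd : 1 ≤ d) (hθ : θ ∈ cube d)
    (S : Matrix (Fin d) (Fin d) ℝ) :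
    Integrable (fun X => ∫ B, frobSq (resetMat B - covMat θ) ∂(M X)) (gaussianSamples n S) :=
  Integrable.of_bound
    (measurable_integral_kernel (measurable_frobSq_resetMat_sub _)).aestronglyMeasurable 5
    (.of_forall fun _ => abs_integral_le (abs_frobSq_resetMat_sub_le hd hθ))

theorem integrable_attackBound_sq (S : Matrix (Fin d) (Fin d) ℝ) :
    Integrable (fun x => attackBound x ^ 2) (multivariateGaussian 0 S) :=
  (memLp_attackBound S).integrable_sq

theorem attack_sq_le (hd : 1 ≤ d) (hθ : θ ∈ cube d) (x : EuclideanSpace ℝ (Fin d))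
    (B : Matrix (Fin d) (Fin d) ℝ) : attack θ x B ^ 2 ≤ attackBound x ^ 2 := by
  rw [← sq_abs]
  exact pow_le_pow_left₀ (abs_nonneg _) (abs_attack_le hd hθ x B) 2

theorem integrable_integral_attack_sq (hd : 1 ≤ d) (hθ : θ ∈ cube d) :
    Integrable (fun p : Dataset n d × EuclideanSpace ℝ (Fin d) => ∫ B, attack θ p.2 B ^ 2 ∂(M p.1))
      ((gaussianSamples n (covMat θ)).prod (multivariateGaussian 0 (covMat θ))) := by
  have hf : Measurable fun q : (Dataset n d × EuclideanSpace ℝ (Fin d)) ×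
      Matrix (Fin d) (Fin d) ℝ => attack θ q.1.2 q.2 ^ 2 :=
    ((measurable_attack θ).comp ((measurable_snd.comp measurable_fst).prodMk
      measurable_snd)).pow_const 2
  have hsm : StronglyMeasurable fun p : Dataset n d × EuclideanSpace ℝ (Fin d) =>
      ∫ B, attack θ p.2 B ^ 2 ∂(M p.1) :=
    hf.stronglyMeasurable.integral_kernel_prod_right'
      (κ := M.comap (Prod.fst : Dataset n d × EuclideanSpace ℝ (Fin d) → _) measurable_fst)
  have hb : Integrable (fun p : Dataset n d × EuclideanSpace ℝ (Fin d) => attackBound p.2 ^ 2)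
      ((gaussianSamples n (covMat θ)).prod (multivariateGaussian 0 (covMat θ))) :=
    (integrable_attackBound_sq _).comp_snd _
  refine hb.mono' hsm.aestronglyMeasurable (.of_forall fun p => ?_)
  exact abs_integral_le fun B => by
    rw [abs_of_nonneg (sq_nonneg _)]; exact attack_sq_le hd hθ p.2 B

theorem integral_integral_attack_sq_le (hd : 1 ≤ d) (hθ : θ ∈ cube d) :
    ∫ p : Dataset n d × EuclideanSpace ℝ (Fin d), ∫ B, attack θ p.2 B ^ 2 ∂(M p.1)
      ∂((gaussianSamples n (covMat θ)).prod (multivariateGaussian 0 (covMat θ))) ≤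
    gaussianSqVariance * ((1 / (4 * d : ℝ)) ^ 2) ^ 2 * meanSqErr M θ := by
  have hi := integrable_integral_attack_sq (M := M) hd hθ
  rw [integral_prod _ hi, meanSqErr, ← integral_const_mul]
  refine integral_mono hi.integral_prod_left
    ((integrable_integral_frobSq hd hθ _).const_mul _) fun X => ?_
  have hj : Integrable (Function.uncurry fun (x : EuclideanSpace ℝ (Fin d)) B => attack θ x B ^ 2)
      ((multivariateGaussian 0 (covMat θ)).prod (M X)) := by
    have hb : Integrable (fun p : EuclideanSpace ℝ (Fin d) × Matrix (Fin d) (Fin d) ℝ =>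
        attackBound p.1 ^ 2) ((multivariateGaussian 0 (covMat θ)).prod (M X)) :=
      (integrable_attackBound_sq _).comp_fst _
    refine hb.mono' ((measurable_attack θ).pow_const 2).aestronglyMeasurable
      (.of_forall fun p => ?_)
    exact (Real.norm_of_nonneg (sq_nonneg (attack θ p.1 p.2))).trans_le
      (attack_sq_le hd hθ p.1 p.2)
  rw [integral_integral_swap hj, ← integral_const_mul]
  exact integral_mono hj.integral_prod_right
    ((integrable_of_abs_le (measurable_frobSq_resetMat_sub _)
      (abs_frobSq_resetMat_sub_le hd hθ)).const_mul _)
    fun B => integral_attack_sq_le hd hθ B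

theorem integrable_meanWeightedErr_mul_score (hd : 1 ≤ d) (hθ : θ ∈ cube d) (a : Fin d × Fin d) :
    Integrable (fun p : Dataset n d × EuclideanSpace ℝ (Fin d) =>
      meanWeightedErr M θ a p.1 * score θ a p.2)
      ((gaussianSamples n (covMat θ)).prod (multivariateGaussian 0 (covMat θ))) :=
  Integrable.mul_prod (Integrable.of_bound (measurable_meanWeightedErr a).aestronglyMeasurable 3
    (.of_forall (abs_meanWeightedErr_le hd hθ a))) (integrable_score _ θ a)

theorem integral_prod_attack_eq_zero (hd : 1 ≤ d) (hθ : θ ∈ cube d) :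
    ∫ p : Dataset n d × EuclideanSpace ℝ (Fin d), ∫ B, attack θ p.2 B ∂(M p.1)
      ∂((gaussianSamples n (covMat θ)).prod (multivariateGaussian 0 (covMat θ))) = 0 := by
  simp only [integral_attack_eq hd hθ]
  rw [integral_finsetSum _ fun a _ => integrable_meanWeightedErr_mul_score hd hθ a]
  refine Finset.sum_eq_zero fun a _ => ?_
  rw [integral_prod_mul (meanWeightedErr M θ a) (score θ a), integral_score hd hθ, mul_zero]

/-- For x independent of X, the dataset with x in place k has the law of X and its k-th point is x.
Privacy then replaces it by X, of which x is independent: the mean vanishes since the score is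
centred, and the second moment is small by accuracy. -/
theorem neg_integral_attack_le (hd : 1 ≤ d) (hθ : θ ∈ cube d) (hM : IsDP ε δ M) (hε : 0 ≤ ε)
    (hε1 : ε ≤ 1) (hδ : 0 ≤ δ) {l : ℝ} (hl : 0 < l) (k : Fin n) :
    -∫ X : Dataset n d, ∫ B, attack θ (X k) B ∂(M X) ∂(gaussianSamples n (covMat θ)) ≤
      ε * (l + gaussianSqVariance * ((1 / (4 * d : ℝ)) ^ 2) ^ 2 * meanSqErr M θ / l) +
        2 * δ * (9 * (1 / (4 * d : ℝ)) ^ 2 * d) := by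
  set ν := gaussianSamples n (covMat θ) with hν
  set μ := multivariateGaussian 0 (covMat θ) with hμ
  have hmp : MeasurePreserving (fun p : Dataset n d × EuclideanSpace ℝ (Fin d) =>
      Function.update p.1 k p.2) (ν.prod μ) ν := measurePreserving_update_pi μ k
  have hi0 : Integrable (fun X : Dataset n d => ∫ B, attack θ (X k) B ∂(M X)) ν := by
    simp only [integral_attack_eq hd hθ]
    exact integrable_finsetSum _ fun a _ => integrable_bounded_mul_score
      (measurable_meanWeightedErr a) (abs_meanWeightedErr_le hd hθ a) _ _ _ _
  have hi1 : Integrable (fun p : Dataset n d × EuclideanSpace ℝ (Fin d) =>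
      ∫ B, attack θ p.2 B ∂(M (Function.update p.1 k p.2))) (ν.prod μ) := by
    have := hmp.integrable_comp_of_integrable hi0
    simpa [Function.comp_def] using this
  have e0 : ∫ X : Dataset n d, ∫ B, attack θ (X k) B ∂(M X) ∂ν =
      ∫ p : Dataset n d × EuclideanSpace ℝ (Fin d),
        ∫ B, attack θ p.2 B ∂(M (Function.update p.1 k p.2)) ∂(ν.prod μ) := by
    have h3 := integral_map hmp.measurable.aemeasurable
      (f := fun X : Dataset n d => ∫ B, attack θ (X k) B ∂(M X)) (by rw [hmp.map_eq]; exact hi0.1)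
    rw [hmp.map_eq] at h3
    simpa using h3
  have hi2 : Integrable (fun p : Dataset n d × EuclideanSpace ℝ (Fin d) =>
      ∫ B, attack θ p.2 B ∂(M p.1)) (ν.prod μ) := by
    simp only [integral_attack_eq hd hθ]
    exact integrable_finsetSum _ fun a _ => integrable_meanWeightedErr_mul_score hd hθ a
  have hi3 := integrable_integral_attack_sq (M := M) hd hθ
  have hi4 : Integrable (fun p : Dataset n d × EuclideanSpace ℝ (Fin d) => attackBound p.2)
      (ν.prod μ) := ((memLp_attackBound _).integrable one_le_two).comp_snd _
  have hi5 : Integrable (fun p : Dataset n d × EuclideanSpace ℝ (Fin d) =>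
      ε * (l + (∫ B, attack θ p.2 B ^ 2 ∂(M p.1)) / l)) (ν.prod μ) :=
    ((integrable_const l).add (hi3.div_const l)).const_mul ε
  have hi6 : Integrable (fun p : Dataset n d × EuclideanSpace ℝ (Fin d) =>
      -∫ B, attack θ p.2 B ∂(M p.1)) (ν.prod μ) := hi2.neg
  have hi7 : Integrable (fun p : Dataset n d × EuclideanSpace ℝ (Fin d) =>
      -(∫ B, attack θ p.2 B ∂(M p.1)) + ε * (l + (∫ B, attack θ p.2 B ^ 2 ∂(M p.1)) / l))
      (ν.prod μ) := hi6.add hi5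
  have hle := integral_mono hi1.neg (hi7.add (hi4.const_mul (2 * δ))) fun p =>
    integral_attack_update_le hd hθ hM hε hε1 hδ hl p.1 k p.2
  have e1 : ∫ p : Dataset n d × EuclideanSpace ℝ (Fin d), attackBound p.2 ∂(ν.prod μ) =
      ∫ x, attackBound x ∂μ := by
    rw [integral_fun_snd]; simp
  have hA := integral_integral_attack_sq_le (M := M) hd hθ
  have hB := integral_attackBound_le hd hθ
  rw [e0, ← integral_neg]
  refine hle.trans ?_
  rw [integral_add' hi7 (hi4.const_mul (2 * δ)), integral_add hi6 hi5,
    integral_const_mul, integral_const_mul, integral_add (integrable_const l) (hi3.div_const l),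
    integral_div, e1, integral_neg, integral_prod_attack_eq_zero hd hθ, integral_const,
    probReal_univ, one_smul, neg_zero, zero_add]
  gcongr

end DPBound

/-! ### Second moments of the prior. -/

section PriorMoments

variable {d : ℕ}

theorem measurable_param_apply (a : Fin d × Fin d) :
    Measurable fun θ : Fin d × Fin d → ℝ => θ a := measurable_pi_apply a

theorem abs_param_le_one (hd : 1 ≤ d) {θ : Fin d × Fin d → ℝ} (hθ : θ ∈ cube d)
    (a : Fin d × Fin d) : |θ a| ≤ 1 := by
  have := (abs_parabola_le_one hd hθ a).2
  rw [abs_mul, abs_two] at this; linarith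

theorem integrable_param (hd : 1 ≤ d) (a : Fin d × Fin d) :
    Integrable (fun θ => θ a) (paramPrior d) := by
  have := isProbabilityMeasure_paramPrior hd
  refine Integrable.of_bound (measurable_param_apply a).aestronglyMeasurable 1 ?_
  filter_upwards [ae_paramPrior_mem_cube hd] with θ hθ using abs_param_le_one hd hθ a

theorem integrable_param_mul_param (hd : 1 ≤ d) (a b : Fin d × Fin d) :
    Integrable (fun θ => θ a * θ b) (paramPrior d) := by
  refine (integrable_param hd b).bdd_mul (measurable_param_apply a).aestronglyMeasurable (c := 1) ?_
  filter_upwards [ae_paramPrior_mem_cube hd] with θ hθ using abs_param_le_one hd hθ a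

theorem integral_coordPrior_id (d : ℕ) : ∫ t, t ∂(coordPrior d) = 0 := by
  have hle : -(1 / (4 * d : ℝ)) ≤ 1 / (4 * d : ℝ) := by
    have : 0 ≤ 1 / (4 * d : ℝ) := by positivity
    linarith
  rw [coordPrior, ProbabilityTheory.cond, integral_smul_measure, integral_Icc_eq_integral_Ioc,
    ← intervalIntegral.integral_of_le hle, integral_id]
  simp

theorem integral_coordPrior_sq (hd : 1 ≤ d) :
    ∫ t, t ^ 2 ∂(coordPrior d) = (1 / (4 * d : ℝ)) ^ 2 / 3 := by
  have hd' : (0 : ℝ) < d := by exact_mod_cast hd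
  have hr : 0 < 1 / (4 * d : ℝ) := by positivity
  rw [coordPrior, ProbabilityTheory.cond, integral_smul_measure, integral_Icc_eq_integral_Ioc,
    ← intervalIntegral.integral_of_le (by linarith), integral_pow, Real.volume_Icc,
    ENNReal.toReal_inv, ENNReal.toReal_ofReal (by linarith), smul_eq_mul]
  set r := 1 / (4 * d : ℝ)
  have : r - -r ≠ 0 := by linarith
  field_simp
  norm_num
  ring

theorem integral_param (hd : 1 ≤ d) (a : Fin d × Fin d) : ∫ θ, θ a ∂(paramPrior d) = 0 := by
  rw [integral_paramPrior_eq_update hd a (integrable_param hd a)]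
  simp [integral_coordPrior_id]

theorem integral_param_sq (hd : 1 ≤ d) (a : Fin d × Fin d) :
    ∫ θ, θ a * θ a ∂(paramPrior d) = (1 / (4 * d : ℝ)) ^ 2 / 3 := by
  have := isProbabilityMeasure_paramPrior hd
  rw [integral_paramPrior_eq_update hd a (integrable_param_mul_param hd a a)]
  simp only [Function.update_self, ← sq, integral_coordPrior_sq hd, integral_const,
    probReal_univ, one_smul]

theorem integral_param_mul_param_nonneg (hd : 1 ≤ d) (a b : Fin d × Fin d) :
    0 ≤ ∫ θ, θ a * θ b ∂(paramPrior d) := by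
  by_cases h : a = b
  · subst h; exact integral_nonneg fun θ => mul_self_nonneg _
  · rw [integral_paramPrior_eq_update hd b (integrable_param_mul_param hd a b)]
    have e : ∀ θ : Fin d × Fin d → ℝ, ∫ t, θ a * t ∂(coordPrior d) = 0 := fun θ => by
      rw [integral_const_mul, integral_coordPrior_id, mul_zero]
    simp [Function.update_of_ne h, e]

theorem integrable_frobSq_symPart (hd : 1 ≤ d) :
    Integrable (fun θ : Fin d × Fin d → ℝ => frobSq (symPart (Matrix.of fun i j => θ (i, j))))
      (paramPrior d) := by
  simp only [frobSq, symPart_apply, Matrix.of_apply]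
  refine integrable_finsetSum _ fun i _ => integrable_finsetSum _ fun j _ => ?_
  have e : ∀ θ : Fin d × Fin d → ℝ, ((θ (i, j) + θ (j, i)) / 2) ^ 2 =
      1 / 4 * (θ (i, j) * θ (i, j) + θ (j, i) * θ (j, i)) + 1 / 2 * (θ (i, j) * θ (j, i)) :=
    fun θ => by ring
  simp only [e]
  exact (((integrable_param_mul_param hd _ _).add (integrable_param_mul_param hd _ _)).const_mul
    _).add ((integrable_param_mul_param hd _ _).const_mul _)

/-- Each entry of θ has variance r²/3. Averaging (i, j) with (j, i) leaves at least half of it, so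
the d² entries give at least d²r²/6 = 1/96. Nonnegativity of the cross term covers the diagonal and
off-diagonal cases together. -/
theorem le_integral_frobSq_symPart (hd : 1 ≤ d) :
    1 / 96 ≤ ∫ θ : Fin d × Fin d → ℝ, frobSq (symPart (Matrix.of fun i j => θ (i, j)))
      ∂(paramPrior d) := by
  have hd' : (0 : ℝ) < d := by exact_mod_cast hd
  have e : ∀ i j, ∀ θ : Fin d × Fin d → ℝ, ((θ (i, j) + θ (j, i)) / 2) ^ 2 =
      1 / 4 * (θ (i, j) * θ (i, j) + θ (j, i) * θ (j, i)) + 1 / 2 * (θ (i, j) * θ (j, i)) :=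
    fun i j θ => by ring
  have hi : ∀ i j, Integrable (fun θ : Fin d × Fin d → ℝ =>
      1 / 4 * (θ (i, j) * θ (i, j) + θ (j, i) * θ (j, i)) + 1 / 2 * (θ (i, j) * θ (j, i)))
      (paramPrior d) := fun i j =>
    (((integrable_param_mul_param hd _ _).add (integrable_param_mul_param hd _ _)).const_mul
    _).add ((integrable_param_mul_param hd _ _).const_mul _)
  simp only [frobSq, symPart_apply, Matrix.of_apply, e]
  rw [integral_finsetSum _ fun i _ => integrable_finsetSum _ fun j _ => hi i j]
  have h : ∀ i j, (1 / (4 * d : ℝ)) ^ 2 / 6 ≤ ∫ θ : Fin d × Fin d → ℝ,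
      1 / 4 * (θ (i, j) * θ (i, j) + θ (j, i) * θ (j, i)) + 1 / 2 * (θ (i, j) * θ (j, i))
      ∂(paramPrior d) := fun i j => by
    have hs : Integrable (fun θ : Fin d × Fin d → ℝ => θ (i, j) * θ (i, j) + θ (j, i) * θ (j, i))
        (paramPrior d) :=
      (integrable_param_mul_param hd _ _).add (integrable_param_mul_param hd _ _)
    rw [integral_add (hs.const_mul _)
      ((integrable_param_mul_param hd _ _).const_mul _), integral_const_mul, integral_const_mul,
      integral_add (integrable_param_mul_param hd _ _) (integrable_param_mul_param hd _ _),
      integral_param_sq hd, integral_param_sq hd]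
    linarith [integral_param_mul_param_nonneg hd (i, j) (j, i)]
  have h2 : ∀ i, ∑ _j : Fin d, (1 / (4 * d : ℝ)) ^ 2 / 6 ≤ ∫ θ : Fin d × Fin d → ℝ, ∑ j,
      (1 / 4 * (θ (i, j) * θ (i, j) + θ (j, i) * θ (j, i)) + 1 / 2 * (θ (i, j) * θ (j, i)))
      ∂(paramPrior d) := fun i => by
    rw [integral_finsetSum _ fun j _ => hi i j]
    exact Finset.sum_le_sum fun j _ => h i j
  refine le_trans (le_of_eq ?_) (Finset.sum_le_sum fun i _ => h2 i)
  simp only [Finset.sum_const, Finset.card_univ, Fintype.card_fin, nsmul_eq_mul]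
  field_simp
  norm_num

end PriorMoments

/-! ### From the fingerprinting identity to the error of the mechanism. -/

section MeanEstimate

variable {n d : ℕ} {M : Kernel (Dataset n d) (Matrix (Fin d) (Fin d) ℝ)}

/-- The mean of an entry of the truncated estimate, given the data. -/
noncomputable def meanEst (M : Kernel (Dataset n d) (Matrix (Fin d) (Fin d) ℝ))
    (a : Fin d × Fin d) (X : Dataset n d) : ℝ := ∫ B, resetMat B a.1 a.2 ∂(M X)

theorem measurable_meanEst (a : Fin d × Fin d) : Measurable (meanEst M a) :=
  measurable_integral_kernel (measurable_resetMat_apply a.1 a.2)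

variable [IsMarkovKernel M] {θ : Fin d × Fin d → ℝ}

theorem abs_meanEst_le (a : Fin d × Fin d) (X : Dataset n d) : |meanEst M a X| ≤ 3 :=
  abs_integral_le fun B => abs_resetMat_apply_le B a.1 a.2

theorem integrable_meanEst (a : Fin d × Fin d) (S : Matrix (Fin d) (Fin d) ℝ) :
    Integrable (meanEst M a) (gaussianSamples n S) :=
  Integrable.of_bound (measurable_meanEst a).aestronglyMeasurable 3 (.of_forall (abs_meanEst_le a))

theorem meanWeightedErr_eq (a : Fin d × Fin d) (X : Dataset n d) :
    meanWeightedErr M θ a X =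
      ((1 / (4 * d : ℝ)) ^ 2 - θ a ^ 2) * (meanEst M a X - covMat θ a.1 a.2) := by
  have hi : Integrable (fun B => resetMat B a.1 a.2) (M X) :=
    integrable_of_abs_le (measurable_resetMat_apply a.1 a.2)
      fun B => abs_resetMat_apply_le B a.1 a.2
  simp only [meanWeightedErr, weightedErr, Matrix.of_apply, meanEst]
  rw [integral_const_mul, integral_sub hi (integrable_const _)]
  simp

/-- The score has mean zero, so subtracting Σ from the estimate does not change the correlation. The
identity is applied to the estimate, which depends on the data alone; the variance bound needs the
error. -/
theorem sum_integral_attack_eq (hd : 1 ≤ d) (hθ : θ ∈ cube d) :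
    ∑ k : Fin n, ∫ X : Dataset n d, ∫ B, attack θ (X k) B ∂(M X) ∂(gaussianSamples n (covMat θ)) =
      ∑ a, ((1 / (4 * d : ℝ)) ^ 2 - θ a ^ 2) *
        ∫ X, meanEst M a X * ∑ k, score θ a (X k) ∂(gaussianSamples n (covMat θ)) := by
  have hi : ∀ a (k : Fin n), Integrable (fun X : Dataset n d => meanEst M a X * score θ a (X k))
      (gaussianSamples n (covMat θ)) := fun a k =>
    integrable_bounded_mul_score (measurable_meanEst a) (abs_meanEst_le a) _ _ _ _
  have h1 : ∀ k : Fin n, ∫ X : Dataset n d, ∫ B, attack θ (X k) B ∂(M X)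
      ∂(gaussianSamples n (covMat θ)) = ∑ a, ((1 / (4 * d : ℝ)) ^ 2 - θ a ^ 2) *
        ∫ X, meanEst M a X * score θ a (X k) ∂(gaussianSamples n (covMat θ)) := fun k => by
    simp only [integral_attack_eq hd hθ]
    rw [integral_finsetSum _ fun a _ => integrable_bounded_mul_score
      (measurable_meanWeightedErr a) (abs_meanWeightedErr_le hd hθ a) _ _ _ _]
    refine Finset.sum_congr rfl fun a _ => ?_
    have e : ∀ X : Dataset n d, meanWeightedErr M θ a X * score θ a (X k) =
        ((1 / (4 * d : ℝ)) ^ 2 - θ a ^ 2) * (meanEst M a X * score θ a (X k) -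
          covMat θ a.1 a.2 * score θ a (X k)) := fun X => by rw [meanWeightedErr_eq]; ring
    simp only [e]
    rw [integral_const_mul, integral_sub (hi a k) ((integrable_score_eval _ θ a k).const_mul _),
      integral_const_mul, integral_score_eval hd hθ, mul_zero, sub_zero]
  simp only [h1, Finset.mul_sum]
  rw [Finset.sum_comm]
  refine Finset.sum_congr rfl fun a _ => ?_
  rw [integral_finsetSum _ fun k _ => hi a k, Finset.mul_sum]

/-- Replacing the estimate by Σ costs 2⟨θ, B - Σ⟩ ≤ (2/9)‖θ‖_F² + (9/2)‖B - Σ‖_F². The weights are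
chosen so that (2/9)(1/16) = 1/72 is half of the gain (8/3)(1/96) = 1/36. -/
theorem sum_param_mul_meanEst_le (hd : 1 ≤ d) (hθ : θ ∈ cube d) :
    ∑ a, 2 * θ a * ∫ X, meanEst M a X ∂(gaussianSamples n (covMat θ)) ≤
      2 * (4 / 3 * ∑ i, θ (i, i) - 4 / 3 * frobSq (symPart (Matrix.of fun i j => θ (i, j)))) +
        (1 / 72 + 9 / 2 * meanSqErr M θ) := by
  have hcov := sum_param_mul_covMat_le hd hθ
  have hfr := frobSq_param_le hd hθ
  have hpt : ∀ B : Matrix (Fin d) (Fin d) ℝ, ∑ a : Fin d × Fin d,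
      2 * θ a * (resetMat B a.1 a.2 - covMat θ a.1 a.2) ≤
      1 / 72 + 9 / 2 * frobSq (resetMat B - covMat θ) := fun B => by
    have h1 : ∑ a : Fin d × Fin d, 2 * θ a * (resetMat B a.1 a.2 - covMat θ a.1 a.2) ≤
        2 / 9 * frobSq (Matrix.of fun i j => θ (i, j)) +
          9 / 2 * frobSq (resetMat B - covMat θ) := by
      rw [Fintype.sum_prod_type]
      simp only [frobSq, Finset.mul_sum, ← Finset.sum_add_distrib]
      refine Finset.sum_le_sum fun i _ => Finset.sum_le_sum fun j _ => ?_
      simp only [Matrix.of_apply, Matrix.sub_apply]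
      nlinarith [sq_nonneg (2 * θ (i, j) - 9 * (resetMat B i j - covMat θ i j))]
    linarith
  have hri : ∀ X (a : Fin d × Fin d), Integrable (fun B => resetMat B a.1 a.2) (M X) := fun X a =>
    integrable_of_abs_le (measurable_resetMat_apply a.1 a.2)
      fun B => abs_resetMat_apply_le B a.1 a.2
  have hfi : ∀ X, Integrable (fun B => frobSq (resetMat B - covMat θ)) (M X) := fun X =>
    integrable_of_abs_le (measurable_frobSq_resetMat_sub _) (abs_frobSq_resetMat_sub_le hd hθ)
  have hX : ∀ X, ∑ a, 2 * θ a * (meanEst M a X - covMat θ a.1 a.2) ≤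
      1 / 72 + 9 / 2 * ∫ B, frobSq (resetMat B - covMat θ) ∂(M X) := fun X => by
    have h := integral_mono (μ := M X)
      (integrable_finsetSum Finset.univ fun (a : Fin d × Fin d) _ =>
        ((hri X a).sub (integrable_const (covMat θ a.1 a.2))).const_mul (2 * θ a))
      ((integrable_const (1 / 72 : ℝ)).add ((hfi X).const_mul (9 / 2))) hpt
    rw [integral_finsetSum _ fun (a : Fin d × Fin d) _ =>
        ((hri X a).sub (integrable_const (covMat θ a.1 a.2))).const_mul (2 * θ a),
      integral_add' (integrable_const (1 / 72 : ℝ)) ((hfi X).const_mul (9 / 2)),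
      integral_const_mul, integral_const, probReal_univ, one_smul] at h
    refine le_trans (le_of_eq (Finset.sum_congr rfl fun a _ => ?_)) h
    simp only [Pi.sub_apply]
    rw [integral_const_mul, integral_sub (hri X a) (integrable_const _), integral_const,
      probReal_univ, one_smul, meanEst]
  have hmi := fun a => integrable_meanEst (M := M) a (covMat θ)
  have hei := integrable_integral_frobSq (M := M) hd hθ (covMat θ)
  have hdi : ∀ a : Fin d × Fin d, Integrable
      (fun X => 2 * θ a * (meanEst M a X - covMat θ a.1 a.2)) (gaussianSamples n (covMat θ)) :=
    fun a => ((hmi a).sub (integrable_const (covMat θ a.1 a.2))).const_mul (2 * θ a)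
  have h := integral_mono (μ := gaussianSamples n (covMat θ))
    (integrable_finsetSum Finset.univ fun (a : Fin d × Fin d) _ => hdi a)
    ((integrable_const (1 / 72 : ℝ)).add (hei.const_mul (9 / 2))) hX
  rw [integral_finsetSum _ fun (a : Fin d × Fin d) _ => hdi a,
    integral_add' (integrable_const (1 / 72 : ℝ)) (hei.const_mul (9 / 2)),
    integral_const_mul, integral_const, probReal_univ, one_smul] at h
  have e : ∀ a : Fin d × Fin d, ∫ X, 2 * θ a * (meanEst M a X - covMat θ a.1 a.2)
      ∂(gaussianSamples n (covMat θ)) =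
      2 * θ a * ∫ X, meanEst M a X ∂(gaussianSamples n (covMat θ)) -
        2 * (θ a * covMat θ a.1 a.2) := fun a => by
    rw [integral_const_mul, integral_sub (hmi a) (integrable_const _), integral_const,
      probReal_univ, one_smul]
    ring
  simp only [e, Finset.sum_sub_distrib, ← Finset.mul_sum] at h
  rw [Fintype.sum_prod_type (fun a : Fin d × Fin d => θ a * covMat θ a.1 a.2)] at h
  rw [meanSqErr]
  linarith

end MeanEstimate

/-! ### The law of Σ and the transfer of the accuracy hypothesis. -/

section Accuracy

variable {n d : ℕ}

theorem borelSpace_matrix (d : ℕ) : BorelSpace (Matrix (Fin d) (Fin d) ℝ) :=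
  inferInstanceAs (BorelSpace (Fin d → Fin d → ℝ))

theorem secondCountableTopology_matrix (d : ℕ) :
    SecondCountableTopology (Matrix (Fin d) (Fin d) ℝ) :=
  inferInstanceAs (SecondCountableTopology (Fin d → Fin d → ℝ))

theorem measurable_matrix {α : Type*} [MeasurableSpace α] {f : α → Matrix (Fin d) (Fin d) ℝ}
    (hf : ∀ i j, Measurable fun a => f a i j) : Measurable f :=
  measurable_pi_lambda (X := fun _ : Fin d => Fin d → ℝ) f fun i => measurable_pi_lambda _ (hf i)

theorem measurable_matrix_inv :
    Measurable fun S : Matrix (Fin d) (Fin d) ℝ => S⁻¹ := by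
  have := borelSpace_matrix d
  refine measurable_matrix fun i j => ?_
  have h : (fun S : Matrix (Fin d) (Fin d) ℝ => S⁻¹ i j) = fun S => (S.det)⁻¹ * S.adjugate i j := by
    ext S; simp [Matrix.inv_def]
  rw [h]
  exact (continuous_id.matrix_det.measurable.inv).mul
    (continuous_id.matrix_adjugate.matrix_elem i j).measurable

theorem measurable_covMat : Measurable (covMat : (Fin d × Fin d → ℝ) → _) :=
  measurable_matrix measurable_covMat_apply

theorem isCompact_cube (d : ℕ) : IsCompact (cube d) := by
  have h : cube d = Set.univ.pi fun _ => Set.Icc (-(1 / (4 * d : ℝ))) (1 / (4 * d : ℝ)) := by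
    ext θ; simp only [cube, Set.mem_ofPred_eq, Set.mem_univ_pi]
  rw [h]
  exact isCompact_univ_pi fun _ => isCompact_Icc

/-- Compactness of the image gives the measurability needed to transfer almost sure membership to
the law of Σ. -/
theorem measurableSet_covMat_image_cube (hd : 1 ≤ d) : MeasurableSet (covMat '' cube d) := by
  have := borelSpace_matrix d
  refine ((isCompact_cube d).image_of_continuousOn ?_).measurableSet
  refine ContinuousOn.mono ?_ fun θ hθ => (posDef_precMat hd hθ).det_pos.ne'
  exact continuousOn_pi.2 fun i => continuousOn_pi.2 fun j => continuousOn_covMat_apply i j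

/-- The law of the covariance matrix under the uniform distribution of the parameter. -/
noncomputable def covPrior (d : ℕ) : Measure (Matrix (Fin d) (Fin d) ℝ) :=
  (paramPrior d).map covMat

theorem isProbabilityMeasure_covPrior (hd : 1 ≤ d) : IsProbabilityMeasure (covPrior d) := by
  have := isProbabilityMeasure_paramPrior hd
  exact Measure.isProbabilityMeasure_map measurable_covMat.aemeasurable

theorem ae_covPrior_mem (hd : 1 ≤ d) : ∀ᵐ S ∂(covPrior d), S ∈ covMat '' cube d := by
  refine (ae_map_iff measurable_covMat.aemeasurable (measurableSet_covMat_image_cube hd)).2 ?_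
  filter_upwards [ae_paramPrior_mem_cube hd] with θ hθ using ⟨θ, hθ, rfl⟩

/-- The mean squared Frobenius error of the truncated estimate as a measurable function of the
covariance matrix. -/
noncomputable def lintegralErr (M : Kernel (Dataset n d) (Matrix (Fin d) (Fin d) ℝ))
    (S : Matrix (Fin d) (Fin d) ℝ) : ℝ≥0∞ :=
  ∫⁻ X, ENNReal.ofReal (sampleDensity S⁻¹ X) *
    ∫⁻ B, ENNReal.ofReal (frobSq (resetMat B - S)) ∂(M X)

variable {M : Kernel (Dataset n d) (Matrix (Fin d) (Fin d) ℝ)}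

theorem lintegralErr_covMat (hd : 1 ≤ d) {θ : Fin d × Fin d → ℝ} (hθ : θ ∈ cube d) :
    lintegralErr M (covMat θ) = ∫⁻ X, ∫⁻ B, ENNReal.ofReal (frobSq (resetMat B - covMat θ)) ∂(M X)
      ∂(gaussianSamples n (covMat θ)) := by
  have hm : Measurable fun X : Dataset n d =>
      ∫⁻ B, ENNReal.ofReal (frobSq (resetMat B - covMat θ)) ∂(M X) :=
    (measurable_frobSq_resetMat_sub _).ennreal_ofReal.lintegral_kernel
  have e : (covMat θ)⁻¹ = precMat θ :=
    Matrix.nonsing_inv_nonsing_inv _ (isUnit_det_precMat hd hθ)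
  have e2 : gaussianSamples n (covMat θ) = (volume : Measure (Dataset n d)).withDensity
      fun X => ENNReal.ofReal (sampleDensity (precMat θ) X) :=
    gaussianSamples_inv (posDef_precMat hd hθ)
  rw [e2, lintegral_withDensity_eq_lintegral_mul _
    (measurable_sampleDensity _).ennreal_ofReal hm, lintegralErr, e]
  rfl

theorem lintegralErr_covMat_le (hd : 1 ≤ d) {θ : Fin d × Fin d → ℝ} (hθ : θ ∈ cube d) :
    lintegralErr M (covMat θ) ≤ ENNReal.ofReal (4 * d) * ∫⁻ X, ∫⁻ B,
      ENNReal.ofReal (normSpectralErr (covMat θ) B ^ 2) ∂(M X)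
        ∂(gaussianSamples n (covMat θ)) := by
  rw [lintegralErr_covMat hd hθ, ← lintegral_const_mul' _ _ ENNReal.ofReal_ne_top]
  refine lintegral_mono fun X => ?_
  rw [← lintegral_const_mul' _ _ ENNReal.ofReal_ne_top]
  refine lintegral_mono fun B => ?_
  rw [← ENNReal.ofReal_mul (by positivity)]
  exact ENNReal.ofReal_le_ofReal ((frobSq_resetMat_sub_le hd hθ B).trans
    (frobSq_sub_le_normSpectralErr (one_le_covMat hd hθ) (covMat_le_two hd hθ) B))

theorem meanSqErr_nonneg (θ : Fin d × Fin d → ℝ) : 0 ≤ meanSqErr M θ :=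
  integral_nonneg fun _ => integral_nonneg fun _ => frobSq_nonneg _

variable [IsMarkovKernel M]

/-- Writing the sample law by its density makes the dependence on `S` jointly measurable with the
data, so the error can be pushed forward along `covMat`. -/
theorem measurable_lintegralErr : Measurable (lintegralErr M) := by
  have := borelSpace_matrix d
  have := secondCountableTopology_matrix d
  have h1 : Measurable fun p : Matrix (Fin d) (Fin d) ℝ × Dataset n d =>
      ENNReal.ofReal (sampleDensity p.1⁻¹ p.2) :=
    (continuous_sampleDensity.measurable.comp
      ((measurable_matrix_inv.comp measurable_fst).prodMk measurable_snd)).ennreal_ofReal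
  have h2 : Measurable fun q : (Matrix (Fin d) (Fin d) ℝ × Dataset n d) ×
      Matrix (Fin d) (Fin d) ℝ => ENNReal.ofReal (frobSq (resetMat q.2 - q.1.1)) :=
    (measurable_frobSq_sub (fun i j => (measurable_resetMat_apply i j).comp measurable_snd)
      fun i j => (measurable_matrix_apply i j).comp
        (measurable_fst.comp measurable_fst)).ennreal_ofReal
  have h3 : Measurable fun p : Matrix (Fin d) (Fin d) ℝ × Dataset n d =>
      ∫⁻ B, ENNReal.ofReal (frobSq (resetMat B - p.1)) ∂(M p.2) :=
    h2.lintegral_kernel_prod_right'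
      (κ := M.comap (Prod.snd : Matrix (Fin d) (Fin d) ℝ × Dataset n d → _) measurable_snd)
  exact (h1.mul h3).lintegral_prod_right'

theorem lintegralErr_covMat_eq_ofReal (hd : 1 ≤ d) {θ : Fin d × Fin d → ℝ} (hθ : θ ∈ cube d) :
    lintegralErr M (covMat θ) = ENNReal.ofReal (meanSqErr M θ) := by
  rw [lintegralErr_covMat hd hθ, meanSqErr, ofReal_integral_eq_lintegral_ofReal
    (integrable_integral_frobSq hd hθ _)
    (.of_forall fun X => integral_nonneg fun B => frobSq_nonneg _)]
  refine lintegral_congr fun X => ?_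
  rw [ofReal_integral_eq_lintegral_ofReal (integrable_of_abs_le
    (measurable_frobSq_resetMat_sub _) (abs_frobSq_resetMat_sub_le hd hθ))
    (.of_forall fun B => frobSq_nonneg _)]

/-- Only the smaller integrand, the truncated Frobenius error, must be measurable in Σ; the spectral
error merely dominates it almost everywhere. -/
theorem lintegral_meanSqErr_le (hd : 1 ≤ d) {α : ℝ}
    (h : meanSqSpectralErr (covPrior d) M ≤ ENNReal.ofReal (α ^ 2)) :
    ∫⁻ θ, ENNReal.ofReal (meanSqErr M θ) ∂(paramPrior d) ≤ ENNReal.ofReal (4 * d * α ^ 2) := by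
  have h1 : ∫⁻ θ, ENNReal.ofReal (meanSqErr M θ) ∂(paramPrior d) =
      ∫⁻ S, lintegralErr M S ∂(covPrior d) := by
    rw [covPrior, lintegral_map measurable_lintegralErr measurable_covMat]
    refine lintegral_congr_ae ?_
    filter_upwards [ae_paramPrior_mem_cube hd] with θ hθ
      using (lintegralErr_covMat_eq_ofReal hd hθ).symm
  rw [h1, ENNReal.ofReal_mul (by positivity)]
  refine le_trans ?_ (mul_le_mul_right h _)
  rw [meanSqSpectralErr, ← lintegral_const_mul' _ _ ENNReal.ofReal_ne_top]
  refine lintegral_mono_ae ?_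
  filter_upwards [ae_covPrior_mem hd] with S hS
  obtain ⟨θ, hθ, rfl⟩ := hS
  exact lintegralErr_covMat_le hd hθ

theorem aestronglyMeasurable_meanSqErr (hd : 1 ≤ d) :
    AEStronglyMeasurable (meanSqErr M) (paramPrior d) := by
  have hm : Measurable fun θ : Fin d × Fin d → ℝ => (lintegralErr M (covMat θ)).toReal :=
    (measurable_lintegralErr.comp measurable_covMat).ennreal_toReal
  refine hm.aestronglyMeasurable.congr ?_
  filter_upwards [ae_paramPrior_mem_cube hd] with θ hθ
  rw [lintegralErr_covMat_eq_ofReal hd hθ, ENNReal.toReal_ofReal (meanSqErr_nonneg θ)]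

theorem integral_meanSqErr_le (hd : 1 ≤ d) {α : ℝ}
    (h : meanSqSpectralErr (covPrior d) M ≤ ENNReal.ofReal (α ^ 2)) :
    Integrable (meanSqErr M) (paramPrior d) ∧
      ∫ θ, meanSqErr M θ ∂(paramPrior d) ≤ 4 * d * α ^ 2 := by
  have hl := lintegral_meanSqErr_le hd h
  have hi : Integrable (meanSqErr M) (paramPrior d) :=
    (lintegral_ofReal_ne_top_iff_integrable (aestronglyMeasurable_meanSqErr hd)
      (.of_forall meanSqErr_nonneg)).1 (ne_top_of_le_ne_top ENNReal.ofReal_ne_top hl)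
  refine ⟨hi, ?_⟩
  rwa [← ofReal_integral_eq_lintegral_ofReal hi (.of_forall meanSqErr_nonneg),
    ENNReal.ofReal_le_ofReal_iff (by positivity)] at hl

end Accuracy

/-! ### Combining the two estimates and choosing constants. -/

section LowerBound

variable {n d : ℕ} {M : Kernel (Dataset n d) (Matrix (Fin d) (Fin d) ℝ)} [IsMarkovKernel M]
  {ε δ : ℝ}

/-- Both sides bound -E ∑_k A_k averaged over the prior: the left one from the identity, with 1/36 -
1/72 = 1/72 remaining, the right one from privacy. -/
theorem lower_bound_of_isDP (hd : 1 ≤ d) (hM : IsDP ε δ M) (hε : 0 ≤ ε) (hε1 : ε ≤ 1)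
    (hδ : 0 ≤ δ) (hW : Integrable (meanSqErr M) (paramPrior d)) {l : ℝ} (hl : 0 < l) :
    1 / 72 - 9 / 2 * ∫ θ, meanSqErr M θ ∂(paramPrior d) ≤
      n * (ε * (l + gaussianSqVariance * ((1 / (4 * d : ℝ)) ^ 2) ^ 2 *
        (∫ θ, meanSqErr M θ ∂(paramPrior d)) / l) + 2 * δ * (9 * (1 / (4 * d : ℝ)) ^ 2 * d)) := by
  have := isProbabilityMeasure_paramPrior hd
  have hfp := fun a => fingerprint_identity (n := n) hd (measurable_meanEst (M := M) a)
    (abs_meanEst_le a) a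
  have hTR : ∫ θ, ∑ a, ((1 / (4 * d : ℝ)) ^ 2 - θ a ^ 2) *
        ∫ X, meanEst M a X * ∑ k, score θ a (X k) ∂(gaussianSamples n (covMat θ)) ∂(paramPrior d) =
      ∫ θ, ∑ a, 2 * θ a * ∫ X, meanEst M a X ∂(gaussianSamples n (covMat θ)) ∂(paramPrior d) := by
    rw [integral_finsetSum _ fun a _ => (hfp a).1, integral_finsetSum _ fun a _ => (hfp a).2.1]
    exact Finset.sum_congr rfl fun a _ => (hfp a).2.2
  have hT := integrable_finsetSum Finset.univ fun a _ => (hfp a).1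
  have hR := integrable_finsetSum Finset.univ fun a _ => (hfp a).2.1
  have hdiag : Integrable (fun θ : Fin d × Fin d → ℝ => ∑ i, θ (i, i)) (paramPrior d) :=
    integrable_finsetSum _ fun i _ => integrable_param hd (i, i)
  have hfs := integrable_frobSq_symPart hd
  have hU1 : Integrable (fun θ : Fin d × Fin d → ℝ =>
      4 / 3 * ∑ i, θ (i, i) - 4 / 3 * frobSq (symPart (Matrix.of fun i j => θ (i, j))))
      (paramPrior d) := (hdiag.const_mul _).sub (hfs.const_mul _)
  have hU2 : Integrable (fun θ : Fin d × Fin d → ℝ => 1 / 72 + 9 / 2 * meanSqErr M θ)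
      (paramPrior d) := (integrable_const _).add (hW.const_mul _)
  have hRle := integral_mono_ae hR ((hU1.const_mul 2).add hU2) (by
    filter_upwards [ae_paramPrior_mem_cube hd] with θ hθ
    exact sum_param_mul_meanEst_le hd hθ)
  have hV1 : Integrable (fun θ : Fin d × Fin d → ℝ => l + gaussianSqVariance *
      ((1 / (4 * d : ℝ)) ^ 2) ^ 2 * meanSqErr M θ / l) (paramPrior d) :=
    (integrable_const _).add ((hW.const_mul _).div_const _)
  have hV2 : Integrable (fun θ : Fin d × Fin d → ℝ => ε * (l + gaussianSqVariance *
      ((1 / (4 * d : ℝ)) ^ 2) ^ 2 * meanSqErr M θ / l) + 2 * δ * (9 * (1 / (4 * d : ℝ)) ^ 2 * d))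
      (paramPrior d) := (hV1.const_mul _).add (integrable_const _)
  have hTle := integral_mono_ae hT.neg (hV2.const_mul (n : ℝ)) (by
    filter_upwards [ae_paramPrior_mem_cube hd] with θ hθ
    rw [Pi.neg_apply, ← sum_integral_attack_eq hd hθ, ← Finset.sum_neg_distrib]
    refine (Finset.sum_le_sum fun k _ =>
      neg_integral_attack_le hd hθ hM hε hε1 hδ hl k).trans (le_of_eq ?_)
    rw [Finset.sum_const, Finset.card_univ, Fintype.card_fin, nsmul_eq_mul])
  have hdiag0 : ∫ θ : Fin d × Fin d → ℝ, ∑ i, θ (i, i) ∂(paramPrior d) = 0 := by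
    rw [integral_finsetSum _ fun i _ => integrable_param hd (i, i)]
    exact Finset.sum_eq_zero fun i _ => integral_param hd (i, i)
  have hlow := le_integral_frobSq_symPart hd
  rw [integral_add' (hU1.const_mul 2) hU2, integral_const_mul,
    integral_sub (hdiag.const_mul _) (hfs.const_mul _), integral_const_mul, integral_const_mul,
    hdiag0, integral_add (integrable_const _) (hW.const_mul _), integral_const_mul, integral_const,
    probReal_univ, one_smul, ← hTR] at hRle
  rw [integral_neg', integral_const_mul, integral_add (hV1.const_mul _) (integrable_const _),
    integral_const_mul, integral_add (integrable_const _) ((hW.const_mul _).div_const _),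
    integral_div, integral_const_mul, integral_const, integral_const, probReal_univ, one_smul,
    one_smul] at hTle
  linarith

theorem sq_le_of_isDP (hd : 1 ≤ d) (hM : IsDP ε δ M) (hε : 0 ≤ ε) (hε1 : ε ≤ 1)
    (hδ : 0 ≤ δ) (hnδ : n * δ ≤ 1 / 324) {α : ℝ} (hα : 0 ≤ α) (hα1 : α ≤ 1 / 60 / √d)
    (h : meanSqSpectralErr (covPrior d) M ≤ ENNReal.ofReal (α ^ 2)) {t : ℝ} (ht : 0 < t) :
    (d : ℝ) ^ 2 / 18 ≤ n * ε * (t + 4 * gaussianSqVariance * (d * α ^ 2) / t) := by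
  have hd' : (1 : ℝ) ≤ d := by exact_mod_cast hd
  obtain ⟨hW, hE⟩ := integral_meanSqErr_le hd h
  -- This scaling pulls the common factor r² = 1/(16d²) out of the whole ε term.
  have hl : 0 < (1 / (4 * d : ℝ)) ^ 2 * t := by positivity
  have key := lower_bound_of_isDP hd hM hε hε1 hδ hW hl
  set E := ∫ θ, meanSqErr M θ ∂(paramPrior d)
  have hv := gaussianSqVariance_nonneg
  have hdα : d * α ^ 2 ≤ 1 / 3600 := by
    have h1 : α * √d ≤ 1 / 60 := (le_div_iff₀ (by positivity)).1 hα1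
    have h2 : (α * √d) ^ 2 ≤ (1 / 60) ^ 2 := pow_le_pow_left₀ (by positivity) h1 2
    rw [mul_pow, Real.sq_sqrt (by positivity)] at h2
    linarith
  have e1 : gaussianSqVariance * ((1 / (4 * d : ℝ)) ^ 2) ^ 2 * E / ((1 / (4 * d : ℝ)) ^ 2 * t) =
      (1 / (4 * d : ℝ)) ^ 2 * (gaussianSqVariance * E / t) := by
    field_simp
  rw [e1] at key
  have h2 : gaussianSqVariance * E / t ≤ 4 * gaussianSqVariance * (d * α ^ 2) / t := by
    refine div_le_div_of_nonneg_right ?_ ht.le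
    nlinarith
  have h3 : (n : ℝ) * ε * (t + gaussianSqVariance * E / t) ≤
      n * ε * (t + 4 * gaussianSqVariance * (d * α ^ 2) / t) := by gcongr
  have e2 : (n : ℝ) * (ε * ((1 / (4 * d : ℝ)) ^ 2 * t + (1 / (4 * d : ℝ)) ^ 2 *
      (gaussianSqVariance * E / t)) + 2 * δ * (9 * (1 / (4 * d : ℝ)) ^ 2 * d)) =
      (n * ε * (t + gaussianSqVariance * E / t) + 18 * (n * δ) * d) / (16 * d ^ 2) := by
    field_simp
    ring
  rw [e2, le_div_iff₀ (by positivity)] at key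
  -- Here 18/324 = 1/18 and d ≤ d²: the δ term uses half of the d²/9 provided by the next line,
  -- where E ≤ 4dα² ≤ 1/900.
  have h4 : 18 * (n * δ) * d ≤ (d : ℝ) ^ 2 / 18 := by nlinarith
  have h5 : (d : ℝ) ^ 2 / 9 ≤ (1 / 72 - 9 / 2 * E) * (16 * d ^ 2) := by
    nlinarith [sq_nonneg (d : ℝ)]
  linarith

end LowerBound

theorem theorem4p9 :
    ∃ c₁ c₂ c₃ : ℝ, 0 < c₁ ∧ 0 < c₂ ∧ 0 < c₃ ∧
      ∀ d : ℕ, 1 ≤ d →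
        ∃ D : Measure (Matrix (Fin d) (Fin d) ℝ), IsProbabilityMeasure D ∧
          (∀ᵐ S ∂D, 1 ≤ S ∧ S ≤ (2 : ℝ) • (1 : Matrix (Fin d) (Fin d) ℝ)) ∧
          ∀ (n : ℕ) (α ε δ : ℝ), 0 ≤ α → α ≤ c₁ / Real.sqrt d →
            0 ≤ ε → ε ≤ 1 → 0 ≤ δ → δ ≤ 1 →
            (n : ℝ) * δ ≤ c₂ →
            (n : ℝ) * δ * Real.log ((n : ℝ) / (d : ℝ) ^ 2) ≤ c₂ * (d : ℝ) ^ 2 →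
            ∀ M : Kernel (Dataset n d) (Matrix (Fin d) (Fin d) ℝ), IsMarkovKernel M →
              IsDP ε δ M →
              meanSqSpectralErr D M ≤ ENNReal.ofReal (α ^ 2) →
              c₃ * (d : ℝ) ^ (3 / 2 : ℝ) ≤ (n : ℝ) * α * ε := by
  have hv := gaussianSqVariance_nonneg
  refine ⟨1 / 60, 1 / 324, 1 / (18 * (1 + 4 * gaussianSqVariance)), by norm_num, by norm_num,
    by positivity, fun d hd => ⟨covPrior d, isProbabilityMeasure_covPrior hd, ?_, ?_⟩⟩
  · filter_upwards [ae_covPrior_mem hd] with S hS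
    obtain ⟨θ, hθ, rfl⟩ := hS
    exact ⟨one_le_covMat hd hθ, covMat_le_two hd hθ⟩
  intro n α ε δ hα hα1 hε hε1 hδ _ hnδ _ M _ hM h
  have hd' : (1 : ℝ) ≤ d := by exact_mod_cast hd
  have hd0 : (0 : ℝ) < d := by linarith
  have key : ∀ t : ℝ, 0 < t → _ := fun t ht => sq_le_of_isDP hd hM hε hε1 hδ hnδ hα hα1 h ht
  rcases hα.eq_or_lt with rfl | hα0
  · exfalso
    -- For α = 0 only nεt remains on the right, and this t makes it less than 1/18 ≤ d²/18.
    have h1 := key (1 / (18 * (n + 1))) (by positivity)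
    have h2 : (n : ℝ) * ε * (1 / (18 * (n + 1))) < 1 / 18 := by
      have : (n : ℝ) * ε ≤ n := mul_le_of_le_one_right (by positivity) hε1
      rw [mul_one_div, div_lt_div_iff₀ (by positivity) (by norm_num)]
      linarith
    simp only [ne_eq, OfNat.ofNat_ne_zero, not_false_eq_true, zero_pow, mul_zero, zero_div,
      add_zero] at h1
    nlinarith
  · have hs : 0 < √(d : ℝ) := Real.sqrt_pos.2 hd0
    have hss : √(d : ℝ) * √(d : ℝ) = d := Real.mul_self_sqrt hd0.le
    -- This t balances t against dα²/t, up to the constant.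
    have h1 := key (√d * α) (by positivity)
    have e1 : 4 * gaussianSqVariance * (d * α ^ 2) / (√d * α) =
        4 * gaussianSqVariance * (√d * α) := by
      rw [div_eq_iff (by positivity)]
      linear_combination (-4 * gaussianSqVariance * α ^ 2) * hss
    have e2 : (d : ℝ) ^ 2 = (d : ℝ) ^ (3 / 2 : ℝ) * √d := by
      rw [Real.sqrt_eq_rpow, ← Real.rpow_add hd0]
      norm_num
    rw [e1, e2] at h1
    rw [div_mul_eq_mul_div, one_mul, div_le_iff₀ (by positivity)]
    refine le_of_mul_le_mul_right ?_ hs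
    linarith
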